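/- For $Q\ge 1$ let $\mathfrak F_Q$ be the Farey sequence of order $Q$, i.e. the set of irreducible fractions $a/q$ with $0\le a\le q\le Q$, $q\ge 1$. For an interval $\mathcal I\subset[0,1]$ of positive length $|\mathcal I|$, let $\gamma_1<\dots<\gamma_N$, $N=N(Q,\mathcal I)$, be the elements of $\mathfrak F_Q\cap\mathcal I$, and put $x_j=N\gamma_j/|\mathcal I|$. For $h\ge 1$ and $N>h+1$ (which holds for all large $Q$), let $\mu_{2,h}^{Q,\mathcal I}$ be the probability measure on $[0,\infty)^h$ given by $$\int f\,d\mu_{2,h}^{Q,\mathcal I}=\frac1{N-h-1}\sum_{j=1}^{N-h-1}f(x_{j+2}-x_j,\;x_{j+3}-x_{j+1},\dots,x_{j+h+1}-x_{j+h-1}).$$ Let $\mathcal T=\{(x,y):0<x\le 1,\ 0<y\le 1,\ x+y>1\}$ be the Farey triangle. Define $L_0(x,y)=x$, $L_1(x,y)=y$, and, for $i\ge 1$, $$k_i=\Big\lfloor\frac{1+L_{i-1}}{L_i}\Big\rfloor,\qquad L_{i+1}=k_iL_i-L_{i-1},$$ and let $\Phi_{2,h}:\mathcal T\to(0,\infty)^h$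 be the map $$\Phi_{2,h}=\frac3{\pi^2}\Big(\frac{k_1}{L_0L_2},\frac{k_2}{L_1L_3},\dots,\frac{k_h}{L_{h-1}L_{h+1}}\Big).$$ Theorem. For every $h\ge 1$ there is a probability measure $\mu_{2,h}$, independent of $\mathcal I$, such that for every interval $\mathcal I\subset[0,1]$ of positive length the measures $\mu_{2,h}^{Q,\mathcal I}$ converge weakly to $\mu_{2,h}$ as $Q\to\infty$. The support of $\mu_{2,h}$ is the closure of the range of $\Phi_{2,h}$, and $$\mu_{2,h}(\mathcal C)=2\,\mathrm{Area}\big(\Phi_{2,h}^{-1}(\mathcal C)\big)$$ for every box $\mathcal C=\prod_{j=1}^h(\alpha_j,\beta_j)\subset(0,\infty)^h$. -/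

import Mathlib

open Filter Topology MeasureTheory
open scoped NNReal ENNReal

noncomputable section

/-- The Farey sequence of order `Q`, as a finite set of real numbers: all irreducible fractions
`a / q` with `0 ≤ a ≤ q` and `1 ≤ q ≤ Q`. -/
def farey (Q : ℕ) : Finset ℝ :=
  ((Finset.Icc 1 Q ×ˢ Finset.range (Q + 1)).filter
    (fun p : ℕ × ℕ => p.2 ≤ p.1 ∧ Nat.Coprime p.2 p.1)).image
    (fun p : ℕ × ℕ => (p.2 : ℝ) / (p.1 : ℝ))

open Classical in
/-- The Farey fractions of order `Q` that lie in the set `I`. -/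
def fareyIn (Q : ℕ) (I : Set ℝ) : Finset ℝ :=
  (farey Q).filter (fun γ => γ ∈ I)

/-- `N(Q, I)`, the number of Farey fractions of order `Q` in `I`. -/
def fareyCount (Q : ℕ) (I : Set ℝ) : ℕ :=
  (fareyIn Q I).card

/-- The Farey fractions of order `Q` in `I` in increasing order, multiplied by `N(Q, I) / |I|`. -/
def fareyNormalized (Q : ℕ) (I : Set ℝ) : Fin (fareyCount Q I) → ℝ :=
  fun j => (fareyCount Q I : ℝ) * (fareyIn Q I).orderEmbOfFin rfl j / volume.real I

/-- The `h`-th level of intervals of a third measure of a finite sequence `x`: the mean of the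
Dirac masses at the vectors `(x_{j+2} - x_j, x_{j+3} - x_{j+1}, …, x_{j+h+1} - x_{j+h-1})`, where
`j` runs over the `N - h - 1` indices for which all these terms exist. It is a probability measure
if `N > h + 1`, and `0` otherwise. -/
def thirdMeasure (h : ℕ) {N : ℕ} (x : Fin N → ℝ) : Measure (Fin h → ℝ) :=
  ((N - h - 1 : ℕ) : ℝ≥0)⁻¹ • ∑ j : Fin (N - h - 1),
    Measure.dirac (fun i : Fin h =>
      x ⟨(j : ℕ) + (i : ℕ) + 2, by omega⟩ - x ⟨(j : ℕ) + (i : ℕ), by omega⟩)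

instance thirdMeasure_isFinite (h : ℕ) {N : ℕ} (x : Fin N → ℝ) :
    IsFiniteMeasure (thirdMeasure h x) := by
  unfold thirdMeasure
  infer_instance

/-- The measure `μ_{2,h}^{Q,I}` of the Farey sequence of order `Q` restricted to `I`. -/
def fareyThirdMeasure (h Q : ℕ) (I : Set ℝ) : FiniteMeasure (Fin h → ℝ) :=
  ⟨thirdMeasure h (fareyNormalized Q I), inferInstance⟩

/-- The Farey triangle. -/
def fareyTriangle : Set (ℝ × ℝ) :=
  {p | 0 < p.1 ∧ p.1 ≤ 1 ∧ 0 < p.2 ∧ p.2 ≤ 1 ∧ 1 < p.1 + p.2}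

/-- The functions `L_0, L_1, L_2, …`. -/
def fareyL : ℕ → ℝ × ℝ → ℝ
  | 0, p => p.1
  | 1, p => p.2
  | n + 2, p => (⌊(1 + fareyL n p) / fareyL (n + 1) p⌋ : ℝ) * fareyL (n + 1) p - fareyL n p

/-- The index `k_{n+1} = ⌊(1 + L_n) / L_{n+1}⌋`. -/
def fareyK (n : ℕ) (p : ℝ × ℝ) : ℤ :=
  ⌊(1 + fareyL n p) / fareyL (n + 1) p⌋

/-- The map `Φ_{2,h}`; only its values on the Farey triangle are used. -/
def fareyPhi (h : ℕ) (p : ℝ × ℝ) : Fin h → ℝ :=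
  fun i => 3 / Real.pi ^ 2 * ((fareyK i p : ℝ) / (fareyL i p * fareyL (i + 2) p))

end

/-! If a/q and its successor in the Farey sequence of order Q have denominators q, q', then the
point (q/Q, q'/Q) of the Farey triangle determines all later denominators. Three consecutive
denominators satisfy d₀ + d₂ = k d₁ with k = ⌊(Q + d₀)/d₁⌋, which is the recurrence of `fareyL`, and
the gap between the outer two fractions is k/(d₀d₂). The vector of normalized gaps starting at a/q
is therefore `fareyScale` times `fareyPhi` at (q/Q, q'/Q) (`fareyEnum_gap`, `fareyNormalized_gap`),
and the scale tends to 1 because N(Q, I)/|I| ~ 3Q²/π².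

It remains to show that (a/q, q/Q, q'/Q) equidistributes in [0,1) times the Farey triangle with
respect to Lebesgue measure times twice the area (`tendsto_fareyLaw`); the factor [0,1) localizes to
I and makes the limit independent of I. Since q' is the integer in (Q - q, Q] congruent to -a⁻¹ mod
q, the quantity (Q - q')/q is, mod 1, (Q + a⁻¹)/q. In the coordinates (a/q, (Q - q')/q, q/Q) on the
3-torus, the Weyl sums over a for fixed q are Kloosterman sums. Any power saving suffices, and
Kloosterman's exponent 3/4 follows from the fourth moment (`norm_kloostermanSum_le`). The
frequencies that see only q/Q are governed by sums of Euler's totient, which give the density 2x.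

The map `fareyPhi` is discontinuous only on a null set, so an extended continuous mapping theorem
(`le_liminf_measure_preimage_of_tendsto`) transfers equidistribution to the gap vectors. Only lower
bounds on open sets are needed, by the portmanteau theorem. For the support, a point where
`fareyPhi` is discontinuous is moved slightly towards the origin: this keeps every index k, rescales
the value by a factor near 1, and lands at a point of continuity inside the triangle. -/

/-! ### Kloosterman sums: the bound with exponent 3/4 from the fourth moment. -/

/-- The Kloosterman sum with parameters `m` and `n` to the modulus `q`. -/
noncomputable def kloostermanSum (q : ℕ) [NeZero q] (m n : ZMod q) : ℂ :=
  ∑ u : (ZMod q)ˣ, ZMod.stdAddChar (m * (u : ZMod q) + n * ((u⁻¹ : (ZMod q)ˣ) : ZMod q))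

section Kloosterman

variable {q : ℕ} [NeZero q]

theorem kloostermanSum_comm (m n : ZMod q) : kloostermanSum q m n = kloostermanSum q n m := by
  unfold kloostermanSum
  rw [← Equiv.sum_comp (Equiv.inv (ZMod q)ˣ)]
  simp [add_comm]

theorem kloostermanSum_smul (m n : ZMod q) (v : (ZMod q)ˣ) :
    kloostermanSum q (m * v) (n * ((v⁻¹ : (ZMod q)ˣ) : ZMod q)) = kloostermanSum q m n := by
  unfold kloostermanSum
  rw [← Equiv.sum_comp (Equiv.mulLeft v) fun u : (ZMod q)ˣ =>
    ZMod.stdAddChar (m * (u : ZMod q) + n * ((u⁻¹ : (ZMod q)ˣ) : ZMod q))]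
  refine Finset.sum_congr rfl fun u _ => ?_
  congr 1
  simp only [Equiv.coe_mulLeft, mul_inv, Units.val_mul]
  ring

/-- Parseval: expand the square and use orthogonality of characters in m and in n, so that only
coincidences of (f, g) survive. -/
theorem sum_norm_sq_sum_stdAddChar {ι : Type*} [Fintype ι] (f g : ι → ZMod q) :
    ∑ m : ZMod q, ∑ n : ZMod q, ‖∑ i, ZMod.stdAddChar (m * f i + n * g i)‖ ^ 2 =
      (q : ℝ) ^ 2 * (Finset.univ.filter fun p : ι × ι => f p.1 = f p.2 ∧ g p.1 = g p.2).card := by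
  have hψ := ZMod.isPrimitive_stdAddChar q
  have key : ∀ m n : ZMod q, ((‖∑ i, ZMod.stdAddChar (m * f i + n * g i)‖ ^ 2 : ℝ) : ℂ) =
      ∑ i, ∑ j, ZMod.stdAddChar (m * (f i - f j)) * ZMod.stdAddChar (n * (g i - g j)) := by
    intro m n
    rw [Complex.ofReal_pow, ← Complex.mul_conj', map_sum, Finset.sum_mul_sum]
    refine Finset.sum_congr rfl fun i _ => Finset.sum_congr rfl fun j _ => ?_
    rw [← AddChar.map_neg_eq_conj, ← AddChar.map_add_eq_mul, ← AddChar.map_add_eq_mul]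
    congr 1
    ring
  have : ((∑ m : ZMod q, ∑ n : ZMod q, ‖∑ i, ZMod.stdAddChar (m * f i + n * g i)‖ ^ 2 : ℝ) : ℂ) =
      ((q : ℝ) ^ 2 *
        (Finset.univ.filter fun p : ι × ι => f p.1 = f p.2 ∧ g p.1 = g p.2).card : ℝ) := by
    push_cast [Complex.ofReal_sum]
    simp_rw [← Complex.ofReal_pow, key]
    calc ∑ m : ZMod q, ∑ n : ZMod q, ∑ i, ∑ j,
          (ZMod.stdAddChar (m * (f i - f j)) * ZMod.stdAddChar (n * (g i - g j)) : ℂ)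
        = ∑ p : ι × ι, (∑ m : ZMod q, (ZMod.stdAddChar (m * (f p.1 - f p.2)) : ℂ)) *
            ∑ n : ZMod q, (ZMod.stdAddChar (n * (g p.1 - g p.2)) : ℂ) := by
          rw [Fintype.sum_prod_type]
          simp_rw [Finset.sum_mul_sum]
          rw [Finset.sum_congr rfl fun m _ => Finset.sum_comm, Finset.sum_comm]
          refine Finset.sum_congr rfl fun i _ => ?_
          rw [Finset.sum_congr rfl fun m _ => Finset.sum_comm, Finset.sum_comm]
      _ = _ := by
          simp_rw [AddChar.sum_mulShift _ hψ, ZMod.card, sub_eq_zero]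
          rw [Finset.card_filter, Nat.cast_sum, Finset.mul_sum]
          refine Finset.sum_congr rfl fun p _ => ?_
          by_cases h1 : f p.1 = f p.2 <;> by_cases h2 : g p.1 = g p.2 <;> simp [h1, h2, sq]
  exact_mod_cast this

/-- For the representative v in [0, q), the remainder of m v mod q is fixed by c, so v is determined
by the quotient ⌊m v/q⌋, which is less than m. -/
theorem card_filter_mul_eq_le (m : ℕ) (hm : m ≠ 0) (c : ZMod q) :
    (Finset.univ.filter fun v : ZMod q => (m : ZMod q) * v = c).card ≤ m := by
  have hq : 0 < q := Nat.pos_of_ne_zero (NeZero.ne q)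
  conv_rhs => rw [← Finset.card_range m]
  refine Finset.card_le_card_of_injOn (fun v => m * v.val / q) ?_ ?_
  · intro v _
    simp only [Finset.coe_range, Set.mem_Iio]
    rw [Nat.div_lt_iff_lt_mul hq]
    exact Nat.mul_lt_mul_of_pos_left (ZMod.val_lt v) (Nat.pos_of_ne_zero hm)
  · intro v hv w hw hvw
    simp only [Finset.coe_filter, Finset.mem_univ, true_and, Set.mem_ofPred_eq] at hv hw hvw
    have h1 : m * v.val % q = m * w.val % q := by
      have : ((m * v.val : ℕ) : ZMod q) = (m * w.val : ℕ) := by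
        push_cast
        rw [ZMod.natCast_zmod_val, ZMod.natCast_zmod_val, hv, hw]
      exact (ZMod.natCast_eq_natCast_iff' _ _ _).1 this
    have h2 : m * v.val = m * w.val := by
      rw [← Nat.div_add_mod (m * v.val) q, ← Nat.div_add_mod (m * w.val) q, h1, hvw]
    exact ZMod.val_injective q (Nat.eq_of_mul_eq_mul_left (Nat.pos_of_ne_zero hm) h2)

theorem card_filter_dvd_val_le {d : ℕ} (hd : d ∣ q) :
    (Finset.univ.filter fun v : ZMod q => d ∣ v.val).card ≤ q / d := by
  have hq : 0 < q := Nat.pos_of_ne_zero (NeZero.ne q)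
  have hd0 : 0 < d := Nat.pos_of_dvd_of_pos hd hq
  conv_rhs => rw [← Finset.card_range (q / d)]
  refine Finset.card_le_card_of_injOn (fun v => v.val / d) ?_ ?_
  · intro v _
    simp only [Finset.coe_range, Set.mem_Iio]
    exact Nat.div_lt_div_of_lt_of_dvd hd (ZMod.val_lt v)
  · intro v hv w hw hvw
    simp only [Finset.coe_filter, Finset.mem_univ, true_and, Set.mem_ofPred_eq] at hv hw hvw
    exact ZMod.val_injective q ((Nat.div_left_inj hv hw).1 hvw)

/-- If q divides w y z, then q = d₁d₂d₃ with d₁ ∣ w, d₂ ∣ y, d₃ ∣ z. Each factorization accounts for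
(q/d₁)(q/d₂)(q/d₃) = q² triples, and there are at most τ(q)² choices of (d₁, d₂). -/
theorem card_filter_mul_mul_eq_zero_le :
    (Finset.univ.filter fun p : ZMod q × ZMod q × ZMod q => p.1 * (p.2.1 * p.2.2) = 0).card ≤
      q.divisors.card ^ 2 * q ^ 2 := by
  have hq : 0 < q := Nat.pos_of_ne_zero (NeZero.ne q)
  set D := (q.divisors ×ˢ q.divisors).filter fun d => d.1 * d.2 ∣ q with hD
  set S : ℕ × ℕ → Finset (ZMod q × ZMod q × ZMod q) := fun d =>
    (Finset.univ.filter fun v : ZMod q => d.1 ∣ v.val) ×ˢ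
    (Finset.univ.filter fun v : ZMod q => d.2 ∣ v.val) ×ˢ
    (Finset.univ.filter fun v : ZMod q => q / (d.1 * d.2) ∣ v.val) with hS
  have hsub : (Finset.univ.filter fun p : ZMod q × ZMod q × ZMod q =>
      p.1 * (p.2.1 * p.2.2) = 0) ⊆ D.biUnion S := by
    rintro ⟨w, y, z⟩ hp
    simp only [Finset.mem_filter, Finset.mem_univ, true_and] at hp
    have h0 : q ∣ w.val * (y.val * z.val) := by
      rw [← ZMod.natCast_eq_zero_iff]
      push_cast
      simpa using hp
    obtain ⟨d1, e, h1, he, hqe⟩ := exists_dvd_and_dvd_of_dvd_mul h0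
    obtain ⟨d2, d3, h2, h3, hed⟩ := exists_dvd_and_dvd_of_dvd_mul he
    have hq' : q = d1 * d2 * d3 := by rw [hqe, hed, mul_assoc]
    have hd12 : 0 < d1 * d2 := Nat.pos_of_dvd_of_pos ⟨d3, hq'⟩ hq
    refine Finset.mem_biUnion.2 ⟨(d1, d2), ?_, ?_⟩
    · simp only [hD, Finset.mem_filter, Finset.mem_product, Nat.mem_divisors]
      exact ⟨⟨⟨⟨e, hqe⟩, hq.ne'⟩, ⟨⟨d1 * d3, by rw [hq']; ring⟩, hq.ne'⟩⟩, ⟨d3, hq'⟩⟩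
    · have : q / (d1 * d2) = d3 := by
        conv_lhs => rw [hq']
        exact Nat.mul_div_cancel_left _ hd12
      simp only [hS, Finset.mem_product, Finset.mem_filter, Finset.mem_univ, true_and, this]
      exact ⟨h1, h2, h3⟩
  calc _ ≤ (D.biUnion S).card := Finset.card_le_card hsub
    _ ≤ D.card * q ^ 2 := by
        refine Finset.card_biUnion_le_card_mul _ _ _ fun d hd => ?_
        simp only [hD, Finset.mem_filter, Finset.mem_product, Nat.mem_divisors] at hd
        obtain ⟨⟨⟨h1, -⟩, h2, -⟩, h3⟩ := hd
        have hd12 : 0 < d.1 * d.2 := Nat.pos_of_dvd_of_pos h3 hq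
        simp only [hS, Finset.card_product]
        calc _ ≤ (q / d.1) * ((q / d.2) * (q / (q / (d.1 * d.2)))) :=
              Nat.mul_le_mul (card_filter_dvd_val_le h1) (Nat.mul_le_mul
                (card_filter_dvd_val_le h2) (card_filter_dvd_val_le (Nat.div_dvd_of_dvd h3)))
          _ = q ^ 2 := by
              rw [Nat.div_div_self h3 hq.ne']
              calc _ = (d.1 * (q / d.1)) * (d.2 * (q / d.2)) := by ring
                _ = q ^ 2 := by rw [Nat.mul_div_cancel' h1, Nat.mul_div_cancel' h2, sq]
    _ ≤ q.divisors.card ^ 2 * q ^ 2 := by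
        refine Nat.mul_le_mul_right _ ((Finset.card_filter_le _ _).trans ?_)
        rw [Finset.card_product, sq]

/-- The substitution w = 2x + y + z is at most two-to-one, also for even q, which reduces the count
to the previous one. -/
theorem card_filter_mul_mul_two_mul_add_le :
    (Finset.univ.filter fun p : ZMod q × ZMod q × ZMod q =>
      (2 * p.1 + p.2.1 + p.2.2) * (p.2.1 * p.2.2) = 0).card ≤
      2 * (q.divisors.card ^ 2 * q ^ 2) := by
  refine (Finset.card_le_mul_card_image (f := fun p : ZMod q × ZMod q × ZMod q =>
    (2 * p.1 + p.2.1 + p.2.2, p.2.1, p.2.2)) _ 2 ?_).trans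
      (Nat.mul_le_mul_left _ ((Finset.card_le_card ?_).trans card_filter_mul_mul_eq_zero_le))
  · rintro ⟨w, y, z⟩ -
    refine le_trans ?_ (card_filter_mul_eq_le (q := q) 2 two_ne_zero (w - y - z))
    refine Finset.card_le_card_of_injOn (fun p => p.1) ?_ ?_
    · rintro ⟨x', y', z'⟩ hp
      simp only [Finset.coe_filter, Finset.mem_filter, Finset.mem_univ, true_and,
        Set.mem_ofPred_eq, Prod.mk.injEq] at hp ⊢
      obtain ⟨-, h, rfl, rfl⟩ := hp
      rw [← h]; push_cast; ring
    · rintro ⟨x', y', z'⟩ hp ⟨x'', y'', z''⟩ hp' h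
      simp only [Finset.coe_filter, Finset.mem_filter, Finset.mem_univ, true_and,
        Set.mem_ofPred_eq, Prod.mk.injEq] at hp hp' h ⊢
      exact ⟨h, hp.2.2.1.trans hp'.2.2.1.symm, hp.2.2.2.trans hp'.2.2.2.symm⟩
  · intro p hp
    simp only [Finset.mem_image, Finset.mem_filter, Finset.mem_univ, true_and] at hp ⊢
    obtain ⟨p', h, rfl⟩ := hp
    exact h

/-- Clearing denominators gives (a + b)(cd - ab) = 0, and d = a + b - c turns this into (a + b)(c -
a)(b - c) = 0. With x = a, y = c - a, z = b - c the first factor is 2x + y + z. -/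
theorem card_additive_quadruples_units_le :
    (Finset.univ.filter fun p : ((ZMod q)ˣ × (ZMod q)ˣ) × ((ZMod q)ˣ × (ZMod q)ˣ) =>
      (p.1.1 : ZMod q) + p.1.2 = p.2.1 + p.2.2 ∧
      ((p.1.1⁻¹ : (ZMod q)ˣ) : ZMod q) + ((p.1.2⁻¹ : (ZMod q)ˣ) : ZMod q) =
        ((p.2.1⁻¹ : (ZMod q)ˣ) : ZMod q) + ((p.2.2⁻¹ : (ZMod q)ˣ) : ZMod q)).card ≤
      2 * (q.divisors.card ^ 2 * q ^ 2) := by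
  refine le_trans ?_ card_filter_mul_mul_two_mul_add_le
  refine Finset.card_le_card_of_injOn (fun p =>
    ((p.1.1 : ZMod q), (p.2.1 : ZMod q) - p.1.1, (p.1.2 : ZMod q) - p.2.1)) ?_ ?_
  · rintro ⟨⟨a, b⟩, c, d⟩ hp
    simp only [Finset.coe_filter, Finset.mem_univ, true_and, Set.mem_ofPred_eq] at hp ⊢
    obtain ⟨h1, h2⟩ := hp
    have ha : (a : ZMod q) * ((a⁻¹ : (ZMod q)ˣ) : ZMod q) = 1 := a.mul_inv
    have hb : (b : ZMod q) * ((b⁻¹ : (ZMod q)ˣ) : ZMod q) = 1 := b.mul_inv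
    have hc : (c : ZMod q) * ((c⁻¹ : (ZMod q)ˣ) : ZMod q) = 1 := c.mul_inv
    have hd : (d : ZMod q) * ((d⁻¹ : (ZMod q)ˣ) : ZMod q) = 1 := d.mul_inv
    generalize ((a⁻¹ : (ZMod q)ˣ) : ZMod q) = a' at *
    generalize ((b⁻¹ : (ZMod q)ˣ) : ZMod q) = b' at *
    generalize ((c⁻¹ : (ZMod q)ˣ) : ZMod q) = c' at *
    generalize ((d⁻¹ : (ZMod q)ˣ) : ZMod q) = d' at *
    generalize (a : ZMod q) = a at *
    generalize (b : ZMod q) = b at *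
    generalize (c : ZMod q) = c at *
    generalize (d : ZMod q) = d at *
    have h3 : (a + b) * (c * d) = (c + d) * (a * b) := by
      have e1 : (a' + b') * (a * b * (c * d)) = (a + b) * (c * d) := by
        linear_combination (b * c * d) * ha + (a * c * d) * hb
      have e2 : (c' + d') * (a * b * (c * d)) = (c + d) * (a * b) := by
        linear_combination (a * b * d) * hc + (a * b * c) * hd
      rw [← e1, ← e2, h2]
    obtain rfl : d = a + b - c := by rw [h1]; ring
    linear_combination h3
  · rintro ⟨⟨a, b⟩, c, d⟩ hp ⟨⟨a', b'⟩, c', d'⟩ hp' h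
    simp only [Finset.coe_filter, Finset.mem_univ, true_and, Set.mem_ofPred_eq, Prod.mk.injEq]
      at hp hp' h ⊢
    obtain ⟨h1, h2, h3⟩ := h
    have hc : (c : ZMod q) = c' := by rw [h1] at h2; exact sub_left_injective h2
    have hb : (b : ZMod q) = b' := by rw [hc] at h3; exact sub_left_injective h3
    have hd : (d : ZMod q) = d' := by
      have e1 := hp.1
      rw [h1, hb, hc, hp'.1] at e1
      exact (add_left_cancel e1).symm
    exact ⟨⟨Units.ext h1, Units.ext hb⟩, Units.ext hc, Units.ext hd⟩

/-- The square of the Kloosterman sum is an exponential sum over pairs of units, so its mean square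
counts the quadruples of the preceding lemma. -/
theorem sum_norm_kloostermanSum_pow_four_le :
    ∑ m : ZMod q, ∑ n : ZMod q, ‖kloostermanSum q m n‖ ^ 4 ≤
      2 * (q : ℝ) ^ 4 * (q.divisors.card : ℝ) ^ 2 := by
  have key : ∀ m n : ZMod q, ‖kloostermanSum q m n‖ ^ 4 =
      ‖∑ p : (ZMod q)ˣ × (ZMod q)ˣ, ZMod.stdAddChar (m * ((p.1 : ZMod q) + (p.2 : ZMod q)) +
        n * (((p.1⁻¹ : (ZMod q)ˣ) : ZMod q) + ((p.2⁻¹ : (ZMod q)ˣ) : ZMod q)))‖ ^ 2 := by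
    intro m n
    rw [show 4 = 2 * 2 from rfl, pow_mul, ← norm_pow, sq (kloostermanSum q m n), kloostermanSum,
      Finset.sum_mul_sum, Fintype.sum_prod_type]
    refine congrArg (fun z : ℂ => ‖z‖ ^ 2)
      (Finset.sum_congr rfl fun u _ => Finset.sum_congr rfl fun v _ => ?_)
    rw [← AddChar.map_add_eq_mul]
    congr 1
    ring
  simp_rw [key]
  rw [sum_norm_sq_sum_stdAddChar]
  have := card_additive_quadruples_units_le (q := q)
  have h2 : (((Finset.univ.filter fun p : ((ZMod q)ˣ × (ZMod q)ˣ) × ((ZMod q)ˣ × (ZMod q)ˣ) =>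
      (p.1.1 : ZMod q) + p.1.2 = p.2.1 + p.2.2 ∧
      ((p.1.1⁻¹ : (ZMod q)ˣ) : ZMod q) + ((p.1.2⁻¹ : (ZMod q)ˣ) : ZMod q) =
        ((p.2.1⁻¹ : (ZMod q)ˣ) : ZMod q) + ((p.2.2⁻¹ : (ZMod q)ˣ) : ZMod q)).card : ℕ) : ℝ) ≤
      2 * ((q.divisors.card : ℝ) ^ 2 * (q : ℝ) ^ 2) := by exact_mod_cast this
  nlinarith [sq_nonneg (q : ℝ)]

theorem le_totient_mul_card_divisors (q : ℕ) : q ≤ q.totient * q.divisors.card := by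
  rcases Nat.eq_zero_or_pos q with rfl | hq
  · simp
  conv_lhs => rw [← Nat.sum_totient q]
  rw [mul_comm, ← smul_eq_mul]
  exact Finset.sum_le_card_nsmul _ _ _ fun d hd => Nat.le_of_dvd (Nat.totient_pos.2 hq)
    (Nat.totient_dvd_of_dvd (Nat.dvd_of_mem_divisors hd))

/-- The sum is unchanged under (m, n) ↦ (m v, n v⁻¹), so one value appears φ(q) times in the fourth
moment, up to the multiplicity |m| with which v is recovered from m v. -/
theorem totient_mul_norm_kloostermanSum_pow_four_le (m : ℤ) (hm : m ≠ 0) (n : ZMod q) :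
    (q.totient : ℝ) * ‖kloostermanSum q m n‖ ^ 4 ≤
      m.natAbs * (2 * (q : ℝ) ^ 4 * (q.divisors.card : ℝ) ^ 2) := by
  classical
  have hfib : ∀ x : ZMod q × ZMod q, (Finset.univ.filter fun v : (ZMod q)ˣ =>
      ((m : ZMod q) * v, n * ((v⁻¹ : (ZMod q)ˣ) : ZMod q)) = x).card ≤ m.natAbs := by
    rintro ⟨c, c'⟩
    -- The sign of m is absorbed into the right-hand side, since the counting lemma takes a natural
    -- multiplier.
    obtain ⟨c₀, hc₀⟩ : ∃ c₀ : ZMod q, ∀ v : ZMod q,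
        (m : ZMod q) * v = c → (m.natAbs : ZMod q) * v = c₀ := by
      rcases Int.natAbs_eq m with h | h
      · exact ⟨c, fun v hv => by rw [← hv]; conv_rhs => rw [h]
                                 simp⟩
      · exact ⟨-c, fun v hv => by rw [← hv]; conv_rhs => rw [h]
                                  simp⟩
    refine le_trans ?_ (card_filter_mul_eq_le m.natAbs (Int.natAbs_ne_zero.2 hm) c₀)
    refine Finset.card_le_card_of_injOn (fun v => (v : ZMod q)) ?_ (Units.val_injective.injOn)
    intro v hv
    simp only [Finset.coe_filter, Finset.mem_univ, true_and, Set.mem_ofPred_eq,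
      Prod.mk.injEq] at hv ⊢
    exact hc₀ _ hv.1
  calc (q.totient : ℝ) * ‖kloostermanSum q m n‖ ^ 4
      = ∑ v : (ZMod q)ˣ, ‖kloostermanSum q (m * v) (n * ((v⁻¹ : (ZMod q)ˣ) : ZMod q))‖ ^ 4 := by
        simp_rw [kloostermanSum_smul]
        rw [Finset.sum_const, Finset.card_univ, ZMod.card_units_eq_totient, nsmul_eq_mul]
    _ = ∑ x : ZMod q × ZMod q, ∑ v ∈ Finset.univ.filter (fun v : (ZMod q)ˣ =>
          ((m : ZMod q) * v, n * ((v⁻¹ : (ZMod q)ˣ) : ZMod q)) = x),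
            ‖kloostermanSum q (m * v) (n * ((v⁻¹ : (ZMod q)ˣ) : ZMod q))‖ ^ 4 :=
        (Finset.sum_fiberwise _ _ _).symm
    _ ≤ ∑ x : ZMod q × ZMod q, m.natAbs * ‖kloostermanSum q x.1 x.2‖ ^ 4 := by
        refine Finset.sum_le_sum fun x _ => ?_
        calc _ = ∑ v ∈ Finset.univ.filter (fun v : (ZMod q)ˣ =>
              ((m : ZMod q) * v, n * ((v⁻¹ : (ZMod q)ˣ) : ZMod q)) = x),
                ‖kloostermanSum q x.1 x.2‖ ^ 4 := by
              refine Finset.sum_congr rfl fun v hv => ?_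
              rw [← (Finset.mem_filter.1 hv).2]
          _ ≤ _ := by
              rw [Finset.sum_const, nsmul_eq_mul]
              exact mul_le_mul_of_nonneg_right (by exact_mod_cast hfib x) (by positivity)
    _ ≤ _ := by
        rw [← Finset.mul_sum, Fintype.sum_prod_type]
        exact mul_le_mul_of_nonneg_left sum_norm_kloostermanSum_pow_four_le (by positivity)

/-- Dividing by φ(q) ≥ q/τ(q) gives |K|⁴ ≤ 2|m| q³ τ(q)³. The constant depends on the integer m
only, as needed for a fixed frequency and varying q. -/
theorem norm_kloostermanSum_le (m : ℤ) (hm : m ≠ 0) (n : ZMod q) :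
    ‖kloostermanSum q m n‖ ≤
      2 * m.natAbs * ((q : ℝ) ^ (3 / 4 : ℝ) * (q.divisors.card : ℝ)) := by
  have hq : 0 < q := Nat.pos_of_ne_zero (NeZero.ne q)
  have hq' : (0 : ℝ) < q := by exact_mod_cast hq
  have hτ : (1 : ℝ) ≤ q.divisors.card := by
    exact_mod_cast Finset.card_pos.2 ⟨1, Nat.one_mem_divisors.2 hq.ne'⟩
  have hm1 : (1 : ℝ) ≤ m.natAbs := by exact_mod_cast Int.natAbs_pos.2 hm
  have h1 := totient_mul_norm_kloostermanSum_pow_four_le m hm n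
  have h2 : (q : ℝ) ≤ q.totient * q.divisors.card := by
    exact_mod_cast le_totient_mul_card_divisors q
  set K := ‖kloostermanSum q m n‖
  set τ : ℝ := (q.divisors.card : ℝ)
  set M : ℝ := (m.natAbs : ℝ)
  have h3 : (q : ℝ) * K ^ 4 ≤ q * (2 * M * (q : ℝ) ^ 3 * τ ^ 3) :=
    calc (q : ℝ) * K ^ 4 ≤ (q.totient * τ) * K ^ 4 :=
          mul_le_mul_of_nonneg_right h2 (by positivity)
      _ = τ * (q.totient * K ^ 4) := by ring
      _ ≤ τ * (M * (2 * (q : ℝ) ^ 4 * τ ^ 2)) :=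
          mul_le_mul_of_nonneg_left h1 (by positivity)
      _ = _ := by ring
  have h4 : K ^ 4 ≤ 2 * M * (q : ℝ) ^ 3 * τ ^ 3 := le_of_mul_le_mul_left h3 hq'
  have h5 : ((q : ℝ) ^ (3 / 4 : ℝ)) ^ 4 = (q : ℝ) ^ 3 := by
    rw [← Real.rpow_natCast, ← Real.rpow_mul hq'.le, ← Real.rpow_natCast]
    norm_num
  refine le_of_pow_le_pow_left₀ (n := 4) (by norm_num) (by positivity) (h4.trans ?_)
  rw [mul_pow, mul_pow ((q : ℝ) ^ (3 / 4 : ℝ)), h5]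
  -- Raising 2M and τ³ to fourth powers is wasteful but avoids further fractional exponents.
  calc 2 * M * (q : ℝ) ^ 3 * τ ^ 3 = (2 * M) ^ 1 * ((q : ℝ) ^ 3 * τ ^ 3) := by ring
    _ ≤ (2 * M) ^ 4 * ((q : ℝ) ^ 3 * τ ^ 4) := by
      gcongr
      · linarith
      · norm_num
      · norm_num

end Kloosterman

/-! ### Asymptotics of the totient summatory function. -/

/-- The summatory function of Euler's totient. -/
def totientSum (N : ℕ) : ℕ := ∑ q ∈ Finset.Ioc 0 N, q.totient

section Totient

open ArithmeticFunction in
-- From φ = μ * id, summing id first over m ≤ N/d.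
theorem totientSum_eq_sum_moebius (N : ℕ) :
    (totientSum N : ℝ) = ∑ d ∈ Finset.Ioc 0 N,
      (moebius d : ℝ) * ((N / d : ℕ) * ((N / d : ℕ) + 1 : ℝ) / 2) := by
  let f : ArithmeticFunction ℝ := (moebius : ArithmeticFunction ℝ)
  let g : ArithmeticFunction ℝ := ⟨fun n => (n : ℝ), by simp⟩
  have hg : ∀ n, ∑ m ∈ Finset.Ioc 0 n, g m = n * (n + 1 : ℝ) / 2 := by
    intro n
    induction n with
    | zero => simp
    | succ k ih =>
      rw [← Finset.insert_Ioc_right_eq_Ioc_add_one (by omega), Finset.sum_insert (by simp), ih]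
      simp only [g, coe_mk]
      push_cast
      ring
  have hφ : ∀ n > 0, (f * g) n = (n.totient : ℝ) := by
    have := (sum_eq_iff_sum_mul_moebius_eq (R := ℝ) (f := fun n => (n.totient : ℝ))
      (g := fun n => (n : ℝ))).1 (fun n _ => by exact_mod_cast Nat.sum_totient n)
    intro n hn
    rw [← this n hn, mul_apply]
    simp [f, g]
  have h := sum_Ioc_mul_eq_sum_sum f g N
  rw [Finset.sum_congr rfl fun n hn => hφ n (Finset.mem_Ioc.1 hn).1] at h
  rw [totientSum, Nat.cast_sum, h]
  refine Finset.sum_congr rfl fun d _ => ?_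
  rw [hg]
  simp [f]

open ArithmeticFunction in
theorem tsum_moebius_div_sq : ∑' d : ℕ, (moebius d : ℝ) / (d : ℝ) ^ 2 = 6 / Real.pi ^ 2 := by
  have h2 : (1 : ℝ) < (2 : ℂ).re := by norm_num
  have h := LSeries_zeta_mul_Lseries_moebius h2
  rw [LSeries_zeta_eq_riemannZeta h2, riemannZeta_two] at h
  have h3 : LSeries (fun n => ((moebius n : ℤ) : ℂ)) 2 =
      ((∑' d : ℕ, (moebius d : ℝ) / (d : ℝ) ^ 2 : ℝ) : ℂ) := by
    rw [LSeries, Complex.ofReal_tsum]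
    refine tsum_congr fun n => ?_
    rcases eq_or_ne n 0 with rfl | hn
    · simp
    · rw [LSeries.term_of_ne_zero hn]
      push_cast
      norm_cast
  rw [h3] at h
  have hπ : (Real.pi : ℝ) ≠ 0 := Real.pi_ne_zero
  have h4 : Real.pi ^ 2 / 6 * (∑' d : ℕ, (moebius d : ℝ) / (d : ℝ) ^ 2) = 1 := by
    exact_mod_cast h
  field_simp
  field_simp at h4
  linarith

open ArithmeticFunction in
-- Tannery's theorem: the d-th term of the Möbius sum, divided by N², tends to μ(d)/(2d²) and is
-- dominated by 1/d²; the limits add up to half of 6/π².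
theorem tendsto_totientSum_div_sq :
    Tendsto (fun N : ℕ => (totientSum N : ℝ) / (N : ℝ) ^ 2) atTop (𝓝 (3 / Real.pi ^ 2)) := by
  have hlim : (3 / Real.pi ^ 2 : ℝ) = ∑' d : ℕ, (moebius d : ℝ) * (1 / 2 / (d : ℝ) ^ 2) := by
    have : ∀ d : ℕ, (moebius d : ℝ) * (1 / 2 / (d : ℝ) ^ 2) =
        1 / 2 * ((moebius d : ℝ) / (d : ℝ) ^ 2) := fun d => by ring
    simp_rw [this]
    rw [tsum_mul_left, tsum_moebius_div_sq]
    ring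
  have hfun : ∀ N : ℕ, (totientSum N : ℝ) / (N : ℝ) ^ 2 = ∑' d : ℕ,
      (moebius d : ℝ) * ((N / d : ℕ) * ((N / d : ℕ) + 1 : ℝ) / 2 / (N : ℝ) ^ 2) := by
    intro N
    rw [tsum_eq_sum (s := Finset.Ioc 0 N), totientSum_eq_sum_moebius, Finset.sum_div]
    · exact Finset.sum_congr rfl fun d _ => by ring
    · intro d hd
      rcases Nat.eq_zero_or_pos d with rfl | hd0
      · simp
      · have : N / d = 0 := Nat.div_eq_of_lt (by simp at hd; omega)
        simp [this]
  simp_rw [hfun]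
  rw [hlim]
  refine tendsto_tsum_of_dominated_convergence (bound := fun d : ℕ => 1 / (d : ℝ) ^ 2)
    (Real.summable_one_div_nat_pow.2 (by norm_num)) ?_ ?_
  · intro d
    refine Tendsto.const_mul _ ?_
    rcases Nat.eq_zero_or_pos d with rfl | hd
    · simp
    have hd' : (0 : ℝ) < d := by exact_mod_cast hd
    have h1 : Tendsto (fun N : ℕ => ((N / d : ℕ) : ℝ) / N) atTop (𝓝 (1 / d)) := by
      have h := (tendsto_nat_floor_mul_div_atTop (R := ℝ) (a := 1 / d) (by positivity)).comp
        tendsto_natCast_atTop_atTop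
      refine h.congr fun N => ?_
      simp only [Function.comp]
      rw [← Nat.floor_div_eq_div (K := ℝ)]
      congr 3
      ring
    have h2 : Tendsto (fun N : ℕ => (1 : ℝ) / N) atTop (𝓝 0) := tendsto_one_div_atTop_nhds_zero_nat
    have h3 := ((h1.mul (h1.add h2)).div_const 2)
    rw [show (1 / 2 / (d : ℝ) ^ 2) = 1 / d * (1 / d + 0) / 2 by ring]
    refine h3.congr' ?_
    filter_upwards [eventually_gt_atTop 0] with N hN
    have : (0 : ℝ) < N := by exact_mod_cast hN
    field_simp
  · refine Eventually.of_forall fun N d => ?_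
    have hμ : |(moebius d : ℝ)| ≤ 1 := by exact_mod_cast abs_moebius_le_one
    rw [Real.norm_eq_abs, abs_mul]
    rcases Nat.eq_zero_or_pos d with rfl | hd
    · simp
    rcases Nat.eq_zero_or_pos N with rfl | hN
    · simp
    have hd' : (0 : ℝ) < d := by exact_mod_cast hd
    have hN' : (0 : ℝ) < N := by exact_mod_cast hN
    have h1 : ((N / d : ℕ) : ℝ) ≤ N / d := Nat.cast_div_le
    have h0 : (0 : ℝ) ≤ ((N / d : ℕ) : ℝ) := by positivity
    have h3 : ((N / d : ℕ) : ℝ) ≤ ((N / d : ℕ) : ℝ) ^ 2 := by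
      exact_mod_cast Nat.le_self_pow two_ne_zero _
    have h2 : ((N / d : ℕ) : ℝ) * ((N / d : ℕ) + 1 : ℝ) / 2 / (N : ℝ) ^ 2 ≤ 1 / (d : ℝ) ^ 2 := by
      rw [div_le_iff₀ (by positivity)]
      calc ((N / d : ℕ) : ℝ) * ((N / d : ℕ) + 1 : ℝ) / 2 ≤ ((N / d : ℕ) : ℝ) ^ 2 := by nlinarith
        _ ≤ ((N : ℝ) / d) ^ 2 := by gcongr
        _ = 1 / (d : ℝ) ^ 2 * (N : ℝ) ^ 2 := by ring
    calc |(moebius d : ℝ)| * |_| ≤ 1 * |_| := mul_le_mul_of_nonneg_right hμ (abs_nonneg _)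
      _ ≤ 1 / (d : ℝ) ^ 2 := by
        rw [one_mul, abs_of_nonneg (by positivity)]
        exact h2

theorem totientSum_pos {N : ℕ} (hN : 0 < N) : 0 < totientSum N :=
  Finset.sum_pos (fun _ hq => Nat.totient_pos.2 (Finset.mem_Ioc.1 hq).1)
    ⟨1, Finset.mem_Ioc.2 ⟨one_pos, hN⟩⟩

/-- The limit t² is the distribution function of the density 2x on (0, 1], which becomes the law of
q/Q. -/
theorem tendsto_totientSum_floor_div {t : ℝ} (ht : 0 ≤ t) :
    Tendsto (fun N : ℕ => (totientSum ⌊t * N⌋₊ : ℝ) / totientSum N) atTop (𝓝 (t ^ 2)) := by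
  have hc : (3 / Real.pi ^ 2 : ℝ) ≠ 0 := by positivity
  rcases ht.eq_or_lt with rfl | ht'
  · simp [totientSum]
  have h1 : Tendsto (fun N : ℕ => ((⌊t * N⌋₊ : ℕ) : ℝ) / N) atTop (𝓝 t) :=
    (tendsto_nat_floor_mul_div_atTop (R := ℝ) ht).comp tendsto_natCast_atTop_atTop
  have h2 : Tendsto (fun N : ℕ => ⌊t * N⌋₊) atTop atTop :=
    tendsto_nat_floor_atTop.comp (tendsto_natCast_atTop_atTop.const_mul_atTop ht')
  have h3 := ((tendsto_totientSum_div_sq.comp h2).mul (h1.pow 2)).div tendsto_totientSum_div_sq hc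
  rw [mul_div_cancel_left₀ _ hc] at h3
  refine h3.congr' ?_
  filter_upwards [eventually_gt_atTop 0, h2.eventually_gt_atTop 0] with N hN hN'
  have e1 : (0 : ℝ) < N := by exact_mod_cast hN
  have e2 : (0 : ℝ) < (⌊t * N⌋₊ : ℕ) := by exact_mod_cast hN'
  simp only [Function.comp, Pi.div_apply]
  field_simp

end Totient

/-! ### Averaging the Kloosterman bound over the modulus. -/

section KloostermanAverage

theorem sum_card_divisors_le (Q : ℕ) :
    (∑ q ∈ Finset.Ioc 0 Q, (q.divisors.card : ℝ)) ≤ Q * (1 + Real.log Q) := by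
  have h := ArithmeticFunction.sum_Ioc_sigma0_eq_sum_div Q
  simp only [ArithmeticFunction.sigma_zero_apply] at h
  have h' : (∑ q ∈ Finset.Ioc 0 Q, (q.divisors.card : ℝ)) =
      ∑ n ∈ Finset.Ioc 0 Q, ((Q / n : ℕ) : ℝ) := by exact_mod_cast h
  rw [h']
  have hh := harmonic_le_one_add_log Q
  rw [harmonic_eq_sum_Icc] at hh
  push_cast at hh
  calc _ ≤ ∑ n ∈ Finset.Ioc 0 Q, (Q : ℝ) * (n : ℝ)⁻¹ :=
        Finset.sum_le_sum fun n _ => by rw [← div_eq_mul_inv]; exact Nat.cast_div_le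
    _ = Q * ∑ n ∈ Finset.Icc 1 Q, (n : ℝ)⁻¹ := by rw [Finset.mul_sum]; rfl
    _ ≤ _ := mul_le_mul_of_nonneg_left hh (by positivity)

/-- The sum is at most Q^(7/4) (1 + log Q), because divisor counts have average order log Q. -/
theorem tendsto_sum_rpow_mul_card_divisors_div_sq :
    Tendsto (fun Q : ℕ => (∑ q ∈ Finset.Ioc 0 Q,
      (q : ℝ) ^ (3 / 4 : ℝ) * (q.divisors.card : ℝ)) / (Q : ℝ) ^ 2) atTop (𝓝 0) := by
  have h1 : Tendsto (fun x : ℝ => (1 + Real.log x) / x ^ (1 / 4 : ℝ)) atTop (𝓝 0) := by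
    have ha : Tendsto (fun x : ℝ => 1 / x ^ (1 / 4 : ℝ)) atTop (𝓝 0) :=
      (tendsto_rpow_atTop (by norm_num)).const_div_atTop 1
    have hb : Tendsto (fun x : ℝ => Real.log x / x ^ (1 / 4 : ℝ)) atTop (𝓝 0) :=
      (isLittleO_log_rpow_atTop (by norm_num)).tendsto_div_nhds_zero
    simpa [add_div] using ha.add hb
  refine squeeze_zero' (Eventually.of_forall fun Q => by positivity) ?_
    (h1.comp tendsto_natCast_atTop_atTop)
  filter_upwards [eventually_gt_atTop 0] with Q hQ
  have hQ' : (0 : ℝ) < Q := by exact_mod_cast hQ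
  simp only [Function.comp]
  have h2 : ∑ q ∈ Finset.Ioc 0 Q, (q : ℝ) ^ (3 / 4 : ℝ) * (q.divisors.card : ℝ) ≤
      (Q : ℝ) ^ (3 / 4 : ℝ) * (Q * (1 + Real.log Q)) := by
    refine le_trans ?_ (mul_le_mul_of_nonneg_left (sum_card_divisors_le Q) (by positivity))
    rw [Finset.mul_sum]
    refine Finset.sum_le_sum fun q hq => ?_
    have : (q : ℝ) ≤ Q := by exact_mod_cast (Finset.mem_Ioc.1 hq).2
    gcongr
  rw [div_le_div_iff₀ (by positivity) (by positivity)]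
  have h3 : (Q : ℝ) ^ (3 / 4 : ℝ) * (Q : ℝ) ^ (1 / 4 : ℝ) = Q := by
    rw [← Real.rpow_add hQ']; norm_num
  calc _ ≤ (Q : ℝ) ^ (3 / 4 : ℝ) * (Q * (1 + Real.log Q)) * (Q : ℝ) ^ (1 / 4 : ℝ) := by gcongr
    _ = ((Q : ℝ) ^ (3 / 4 : ℝ) * (Q : ℝ) ^ (1 / 4 : ℝ)) * (Q * (1 + Real.log Q)) := by ring
    _ = _ := by rw [h3]; ring

theorem sum_filter_coprime_eq_sum_units {M : Type*} [AddCommMonoid M] (q : ℕ) [NeZero q]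
    (F : ZMod q → ZMod q → M) :
    ∑ a ∈ (Finset.range q).filter q.Coprime, F a (a : ZMod q)⁻¹ =
      ∑ u : (ZMod q)ˣ, F u ((u⁻¹ : (ZMod q)ˣ) : ZMod q) := by
  symm
  refine Finset.sum_bij (fun (u : (ZMod q)ˣ) _ => (u : ZMod q).val) ?_ ?_ ?_ ?_
  · intro u _
    simp only [Finset.mem_filter, Finset.mem_range]
    exact ⟨ZMod.val_lt _, (ZMod.val_coe_unit_coprime u).symm⟩
  · intro u _ v _ h
    exact Units.ext (ZMod.val_injective q h)
  · intro a ha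
    simp only [Finset.mem_filter, Finset.mem_range] at ha
    refine ⟨ZMod.unitOfCoprime a ha.2.symm, Finset.mem_univ _, ?_⟩
    rw [ZMod.coe_unitOfCoprime, ZMod.val_cast_of_lt ha.1]
  · intro u _
    rw [ZMod.natCast_zmod_val, ZMod.inv_coe_unit]

end KloostermanAverage

/-! ### Empirical measures. -/

/-- The uniform average of the Dirac masses at the points `f i`, `i ∈ s`. -/
noncomputable def meanDirac {ι X : Type*} [MeasurableSpace X] (s : Finset ι) (f : ι → X) :
    Measure X :=
  (s.card : ℝ≥0∞)⁻¹ • ∑ i ∈ s, Measure.dirac (f i)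

section MeanDirac

variable {ι X : Type*} [MeasurableSpace X]

open Classical in
theorem meanDirac_apply (s : Finset ι) (f : ι → X) {A : Set X} (hA : MeasurableSet A) :
    meanDirac s f A = ((s.filter fun i => f i ∈ A).card : ℝ≥0∞) / s.card := by
  rw [meanDirac, Measure.smul_apply, Measure.finsetSum_apply, smul_eq_mul, ENNReal.div_eq_inv_mul,
    Finset.card_filter, Nat.cast_sum]
  congr 1
  refine Finset.sum_congr rfl fun i _ => ?_
  rw [Measure.dirac_apply' _ hA]
  by_cases h : f i ∈ A <;> simp [h]

theorem isProbabilityMeasure_meanDirac {s : Finset ι} (hs : s.Nonempty) (f : ι → X) :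
    IsProbabilityMeasure (meanDirac s f) := by
  classical
  refine ⟨?_⟩
  rw [meanDirac_apply _ _ MeasurableSet.univ]
  simp only [Set.mem_univ, Finset.filter_true]
  exact ENNReal.div_self (by exact_mod_cast hs.card_pos.ne') (ENNReal.natCast_ne_top _)

theorem integral_meanDirac {E : Type*} [NormedAddCommGroup E] [NormedSpace ℝ E] [CompleteSpace E]
    (s : Finset ι) (f : ι → X) {F : X → E} (hF : StronglyMeasurable F) :
    ∫ x, F x ∂(meanDirac s f) = (s.card : ℝ)⁻¹ • ∑ i ∈ s, F (f i) := by
  rw [meanDirac, integral_smul_measure, integral_finsetSum_measure]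
  · simp [integral_dirac' _ _ hF]
  · exact fun i _ => integrable_dirac' hF (by simp)

end MeanDirac

/-! ### Tools for weak convergence. -/

section WeakConvergence

/-- An extended continuous mapping theorem, in terms of open sets. -/
theorem le_liminf_measure_preimage_of_tendsto {X Y : Type*} [MeasurableSpace X]
    [TopologicalSpace X] [OpensMeasurableSpace X] [HasOuterApproxClosed X] [TopologicalSpace Y]
    {P : ℕ → ProbabilityMeasure X} {ρ : ProbabilityMeasure X} (hP : Tendsto P atTop (𝓝 ρ))
    {φ : ℕ → X → Y} {ψ : X → Y}
    (hφ : ∀ᵐ z ∂(ρ : Measure X),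
      Tendsto (fun p : ℕ × X => φ p.1 p.2) (atTop ×ˢ 𝓝 z) (𝓝 (ψ z)))
    {G : Set Y} (hG : IsOpen G) :
    (ρ : Measure X) (ψ ⁻¹' G) ≤ liminf (fun k => (P k : Measure X) (φ k ⁻¹' G)) atTop := by
  -- These open sets increase and cover almost all of the preimage of G under ψ. The portmanteau
  -- theorem applies to each of them, and continuity from below finishes; measurability of φ and ψ
  -- never enters.
  set U : ℕ → Set X := fun K => interior {z | ∀ k ≥ K, φ k z ∈ G} with hU
  have hmono : Monotone U := fun K L hKL =>
    interior_mono fun z hz k hk => hz k (hKL.trans hk)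
  have hsub : ψ ⁻¹' G ≤ᵐ[(ρ : Measure X)] ⋃ K, U K := by
    filter_upwards [hφ] with z hz hzG
    have h1 := hz (hG.mem_nhds hzG)
    rw [mem_map, mem_prod_iff] at h1
    obtain ⟨s, hs, t, ht, hst⟩ := h1
    obtain ⟨K, hK⟩ := mem_atTop_sets.1 hs
    refine Set.mem_iUnion.2 ⟨K, mem_interior_iff_mem_nhds.2 (mem_of_superset ht ?_)⟩
    intro w hw k hk
    exact hst (Set.mk_mem_prod (hK k hk) hw)
  refine (measure_mono_ae hsub).trans ?_
  rw [hmono.measure_iUnion]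
  refine iSup_le fun K => ?_
  refine (ProbabilityMeasure.le_liminf_measure_open_of_tendsto hP isOpen_interior).trans ?_
  refine liminf_le_liminf ?_
  filter_upwards [eventually_ge_atTop K] with k hk
  exact measure_mono fun z hz => interior_subset hz k hk

/-- Weyl's criterion on a torus, for an arbitrary limit measure. -/
theorem tendsto_of_forall_integral_mFourier {d : Type*} [Fintype d]
    {P : ℕ → ProbabilityMeasure (UnitAddTorus d)} {ρ : ProbabilityMeasure (UnitAddTorus d)}
    (h : ∀ n : d → ℤ, Tendsto (fun k => ∫ z, UnitAddTorus.mFourier n z ∂(P k : Measure _)) atTop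
      (𝓝 (∫ z, UnitAddTorus.mFourier n z ∂(ρ : Measure _)))) :
    Tendsto P atTop (𝓝 ρ) := by
  have hint : ∀ (μ : ProbabilityMeasure (UnitAddTorus d)) (F : C(UnitAddTorus d, ℂ)),
      Integrable F (μ : Measure _) := fun μ F =>
    Integrable.of_bound F.continuous.aestronglyMeasurable ‖F‖
      (Eventually.of_forall F.norm_coe_le_norm)
  have hspan : ∀ F ∈ Submodule.span ℂ (Set.range (UnitAddTorus.mFourier (d := d))),
      Tendsto (fun k => ∫ z, F z ∂(P k : Measure _)) atTop (𝓝 (∫ z, F z ∂(ρ : Measure _))) := by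
    intro F hF
    induction hF using Submodule.span_induction with
    | mem x hx => obtain ⟨n, rfl⟩ := hx; exact h n
    | zero => simp
    | add x y _ _ hx hy =>
      simp only [ContinuousMap.add_apply]
      rw [integral_add (hint _ _) (hint _ _)]
      refine (hx.add hy).congr fun k => ?_
      rw [integral_add (hint _ _) (hint _ _)]
    | smul c x _ hx =>
      simp only [ContinuousMap.smul_apply, integral_smul]
      exact hx.const_smul c
  have hdist : ∀ (μ : ProbabilityMeasure (UnitAddTorus d)) (F G : C(UnitAddTorus d, ℂ)),
      dist (∫ z, F z ∂(μ : Measure _)) (∫ z, G z ∂(μ : Measure _)) ≤ dist F G := by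
    intro μ F G
    rw [dist_eq_norm, ← integral_sub (hint _ _) (hint _ _)]
    refine (norm_integral_le_of_norm_le_const (C := dist F G)
      (Eventually.of_forall fun z => ?_)).trans (by simp)
    rw [← dist_eq_norm]
    exact ContinuousMap.dist_apply_le_dist z
  have hall : ∀ F : C(UnitAddTorus d, ℂ),
      Tendsto (fun k => ∫ z, F z ∂(P k : Measure _)) atTop (𝓝 (∫ z, F z ∂(ρ : Measure _))) := by
    intro F
    have hF : F ∈ closure (Submodule.span ℂ (Set.range (UnitAddTorus.mFourier (d := d))) :
        Set C(UnitAddTorus d, ℂ)) := by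
      rw [← Submodule.topologicalClosure_coe, UnitAddTorus.span_mFourier_closure_eq_top]
      trivial
    rw [Metric.tendsto_atTop]
    intro ε hε
    obtain ⟨G, hG, hFG⟩ := Metric.mem_closure_iff.1 hF (ε / 3) (by positivity)
    obtain ⟨K, hK⟩ := Metric.tendsto_atTop.1 (hspan G hG) (ε / 3) (by positivity)
    refine ⟨K, fun k hk => ?_⟩
    have h1 := hdist (P k) F G
    have h2 := hdist ρ G F
    rw [dist_comm G F] at h2
    have h3 := hK k hk
    linarith [dist_triangle4 (∫ z, F z ∂(P k : Measure _)) (∫ z, G z ∂(P k : Measure _))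
      (∫ z, G z ∂(ρ : Measure _)) (∫ z, F z ∂(ρ : Measure _))]
  rw [ProbabilityMeasure.tendsto_iff_forall_integral_tendsto]
  intro f
  have h1 := hall ⟨fun z => (f z : ℂ), by fun_prop⟩
  simp only [ContinuousMap.coe_mk, integral_complex_ofReal] at h1
  exact_mod_cast (Complex.continuous_re.tendsto _).comp h1

end WeakConvergence

/-! ### The limit measure on the triangle and on the torus. -/

/-- The probability measure on `ℝ` with density `2x` on the interval `(0, 1]`. -/
noncomputable def linearDensity : Measure ℝ :=
  (volume.restrict (Set.Ioc 0 1)).withDensity fun x => ENNReal.ofReal (2 * x)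

section LimitMeasure

theorem linearDensity_Iic {t : ℝ} (h0 : 0 ≤ t) (h1 : t ≤ 1) :
    linearDensity (Set.Iic t) = ENNReal.ofReal (t ^ 2) := by
  rw [linearDensity, withDensity_apply _ measurableSet_Iic,
    Measure.restrict_restrict measurableSet_Iic]
  have : Set.Iic t ∩ Set.Ioc 0 1 = Set.Ioc 0 t := by
    ext x; simp only [Set.mem_inter_iff, Set.mem_Iic, Set.mem_Ioc]
    constructor
    · rintro ⟨a, b, c⟩; exact ⟨b, a⟩
    · rintro ⟨a, b⟩; exact ⟨b, a, b.trans h1⟩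
  rw [this, ← ofReal_integral_eq_lintegral_ofReal]
  · rw [← intervalIntegral.integral_of_le h0]
    congr 1
    rw [intervalIntegral.integral_const_mul, integral_id]
    ring
  · exact (by fun_prop : Continuous fun x : ℝ => 2 * x).integrableOn_Ioc
  · filter_upwards [ae_restrict_mem measurableSet_Ioc] with x hx
    have := hx.1
    simp only [Pi.zero_apply]
    linarith

theorem linearDensity_compl_Ioc : linearDensity (Set.Ioc 0 1)ᶜ = 0 := by
  refine withDensity_absolutelyContinuous _ _ ?_
  rw [Measure.restrict_apply measurableSet_Ioc.compl]
  simp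

instance isProbabilityMeasure_linearDensity : IsProbabilityMeasure linearDensity := by
  refine ⟨?_⟩
  have h1 := linearDensity_Iic zero_le_one le_rfl
  refine le_antisymm ?_ ?_
  · rw [← Set.union_compl_self (Set.Ioc (0 : ℝ) 1)]
    refine (measure_union_le _ _).trans ?_
    rw [linearDensity_compl_Ioc, add_zero]
    refine (measure_mono Set.Ioc_subset_Iic_self).trans ?_
    simp [h1]
  · refine le_trans ?_ (measure_mono (Set.subset_univ (Set.Iic 1)))
    simp [h1]

theorem linearDensity_absolutelyContinuous : linearDensity ≪ volume :=
  (withDensity_absolutelyContinuous _ _).trans Measure.absolutelyContinuous_restrict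

theorem measurableSet_fareyTriangle : MeasurableSet fareyTriangle := by
  unfold fareyTriangle
  measurability

/-- For fixed x, the map u ↦ 1 - x u sends [0, 1) onto the fibre (1 - x, 1] of the triangle. Its
Jacobian factor 1/x cancels the x of the density 2x, leaving the constant 2. -/
theorem map_linearDensity :
    ((volume.restrict (Set.Ico (0 : ℝ) 1)).prod linearDensity).map
      (fun w : ℝ × ℝ => (w.2, 1 - w.2 * w.1)) = (2 : ℝ≥0∞) • volume.restrict fareyTriangle := by
  have hg : Measurable (fun w : ℝ × ℝ => (w.2, 1 - w.2 * w.1)) := by fun_prop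
  ext A hA
  rw [Measure.map_apply hg hA, Measure.prod_apply_symm (hg hA), linearDensity,
    lintegral_withDensity_eq_lintegral_mul₀ (by fun_prop)
      (measurable_measure_prodMk_right (hg hA)).aemeasurable, Measure.smul_apply,
    Measure.restrict_apply hA, Measure.volume_eq_prod,
    Measure.prod_apply (hA.inter measurableSet_fareyTriangle), smul_eq_mul,
    ← lintegral_const_mul' _ _ (by simp), ← lintegral_indicator measurableSet_Ioc]
  refine lintegral_congr fun x => ?_
  by_cases hx : x ∈ Set.Ioc (0 : ℝ) 1
  · rw [Set.indicator_of_mem hx, Pi.mul_apply, ENNReal.ofReal_mul (by norm_num), mul_assoc]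
    simp only [ENNReal.ofReal_ofNat]
    congr 1
    set S : Set ℝ := Prod.mk x ⁻¹' (A ∩ fareyTriangle) with hS
    have h1 : ((fun u => (u, x)) ⁻¹' ((fun w : ℝ × ℝ => (w.2, 1 - w.2 * w.1)) ⁻¹' A)) ∩
        Set.Ico 0 1 = (fun u => x * u) ⁻¹' ((fun v => 1 - v) ⁻¹' S) := by
      ext u
      simp only [Set.mem_inter_iff, Set.mem_preimage, Set.mem_Ico, hS, fareyTriangle,
        Set.mem_ofPred_eq]
      obtain ⟨hx0, hx1⟩ := hx
      constructor
      · rintro ⟨h, h0, h1⟩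
        refine ⟨h, hx0, hx1, ?_, ?_, ?_⟩ <;> nlinarith
      · rintro ⟨h, -, -, -, h0, h1⟩
        refine ⟨h, ?_, ?_⟩
        · by_contra hu
          nlinarith
        · by_contra hu
          nlinarith
    have hsub : volume ((fun v : ℝ => 1 - v) ⁻¹' S) = volume S :=
      (Measure.measurePreserving_sub_left volume (1 : ℝ)).measure_preimage
        (measurable_prodMk_left (hA.inter measurableSet_fareyTriangle)).nullMeasurableSet
    rw [Measure.restrict_apply' measurableSet_Ico, h1, Real.volume_preimage_mul_left hx.1.ne',
      hsub, ← mul_assoc, ← ENNReal.ofReal_mul hx.1.le,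
      abs_of_pos (inv_pos.2 hx.1), mul_inv_cancel₀ hx.1.ne', ENNReal.ofReal_one, one_mul]
  · rw [Set.indicator_of_notMem hx]
    have : Prod.mk x ⁻¹' (A ∩ fareyTriangle) = ∅ := by
      ext y
      simp only [Set.mem_preimage, Set.mem_inter_iff, fareyTriangle, Set.mem_ofPred_eq,
        Set.mem_empty_iff_false, iff_false]
      rintro ⟨-, h0, h1, -⟩
      exact hx ⟨h0, h1⟩
    simp [this]

instance isProbabilityMeasure_restrict_Ico :
    IsProbabilityMeasure (volume.restrict (Set.Ico (0 : ℝ) 1)) := ⟨by simp⟩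

instance isProbabilityMeasure_two_smul_fareyTriangle :
    IsProbabilityMeasure ((2 : ℝ≥0∞) • volume.restrict fareyTriangle) := by
  rw [← map_linearDensity]
  exact Measure.isProbabilityMeasure_map (by fun_prop)

/-- The natural map from `ℝ³` to the three-dimensional torus. -/
def toTorus (w : ℝ × ℝ × ℝ) : UnitAddTorus (Fin 3) :=
  ![(w.1 : UnitAddCircle), (w.2.1 : UnitAddCircle), (w.2.2 : UnitAddCircle)]

theorem continuous_toTorus : Continuous toTorus := by
  refine continuous_pi fun i => ?_
  fin_cases i
  · exact (AddCircle.continuous_mk' 1).comp continuous_fst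
  · exact (AddCircle.continuous_mk' 1).comp (continuous_fst.comp continuous_snd)
  · exact (AddCircle.continuous_mk' 1).comp (continuous_snd.comp continuous_snd)

theorem mFourier_toTorus (n : Fin 3 → ℤ) (w : ℝ × ℝ × ℝ) :
    UnitAddTorus.mFourier n (toTorus w) =
      fourier (n 0) (w.1 : UnitAddCircle) *
        (fourier (n 1) (w.2.1 : UnitAddCircle) * fourier (n 2) (w.2.2 : UnitAddCircle)) := by
  simp [UnitAddTorus.mFourier, Fin.prod_univ_three, toTorus, mul_assoc]

/-- The limit measure on the torus. -/
noncomputable def torusLimit : Measure (UnitAddTorus (Fin 3)) :=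
  ((volume.restrict (Set.Ico (0 : ℝ) 1)).prod
    ((volume.restrict (Set.Ico (0 : ℝ) 1)).prod linearDensity)).map toTorus

instance isProbabilityMeasure_torusLimit : IsProbabilityMeasure torusLimit :=
  Measure.isProbabilityMeasure_map continuous_toTorus.measurable.aemeasurable

theorem integral_fourier_Ico {m : ℤ} (hm : m ≠ 0) :
    ∫ x in Set.Ico (0 : ℝ) 1, fourier m (x : UnitAddCircle) = 0 := by
  rw [integral_Ico_eq_integral_Ioc, ← intervalIntegral.integral_of_le zero_le_one]
  have h1 : ∀ x : ℝ, (fourier m (x : UnitAddCircle) : ℂ) =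
      Complex.exp ((2 * Real.pi * Complex.I * m) * x) := fun x => by
    rw [fourier_coe_apply]
    congr 1
    simp
  simp_rw [h1]
  have hne : (2 * Real.pi * Complex.I * m : ℂ) ≠ 0 := by
    simp [Real.pi_ne_zero, hm]
  rw [integral_exp_mul_complex hne]
  have h2 : Complex.exp (2 * Real.pi * Complex.I * m * (1 : ℝ)) = 1 := by
    rw [Complex.exp_eq_one_iff]
    exact ⟨m, by push_cast; ring⟩
  rw [h2]
  simp

/-- The first two coordinates are uniform and independent of the third, so a nonzero frequency in
either of them kills the integral. -/
theorem integral_mFourier_torusLimit (n : Fin 3 → ℤ) :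
    ∫ z, UnitAddTorus.mFourier n z ∂torusLimit =
      if n 0 = 0 ∧ n 1 = 0 then ∫ x, fourier (n 2) (x : UnitAddCircle) ∂linearDensity else 0 := by
  rw [torusLimit, integral_map continuous_toTorus.measurable.aemeasurable
    (UnitAddTorus.mFourier n).continuous.aestronglyMeasurable]
  simp_rw [mFourier_toTorus]
  rw [integral_prod_mul (fun x : ℝ => (fourier (n 0) (x : UnitAddCircle) : ℂ))
    (fun w : ℝ × ℝ => (fourier (n 1) (w.1 : UnitAddCircle) : ℂ) *
      fourier (n 2) (w.2 : UnitAddCircle)),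
    integral_prod_mul (fun x : ℝ => (fourier (n 1) (x : UnitAddCircle) : ℂ))
    (fun x : ℝ => (fourier (n 2) (x : UnitAddCircle) : ℂ))]
  split_ifs with h
  · simp [h.1, h.2]
  · by_cases h0 : n 0 = 0
    · have h1 : n 1 ≠ 0 := fun h1 => h ⟨h0, h1⟩
      rw [integral_fourier_Ico h1]
      simp
    · rw [integral_fourier_Ico h0]
      simp

end LimitMeasure

/-! ### Equidistribution on the torus by Weyl sums. -/

/-- The pairs `⟨q, a⟩` with `1 ≤ q ≤ Q`, `0 ≤ a < q` and `a`, `q` coprime. -/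
def fareyPairs (Q : ℕ) : Finset (Σ _ : ℕ, ℕ) :=
  (Finset.Ioc 0 Q).sigma fun q => (Finset.range q).filter q.Coprime

/-- The difference between `Q` and the denominator of the successor of `a / q` in the Farey
sequence of order `Q`. -/
noncomputable def fareyGap (Q : ℕ) (p : Σ _ : ℕ, ℕ) : ℕ :=
  ((Q : ZMod p.1) + (p.2 : ZMod p.1)⁻¹).val

section Equidistribution

theorem mem_fareyPairs {Q : ℕ} {p : Σ _ : ℕ, ℕ} :
    p ∈ fareyPairs Q ↔ (0 < p.1 ∧ p.1 ≤ Q) ∧ p.2 < p.1 ∧ p.1.Coprime p.2 := by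
  simp [fareyPairs]

theorem card_fareyPairs (Q : ℕ) : (fareyPairs Q).card = totientSum Q := by
  rw [fareyPairs, Finset.card_sigma]
  rfl

theorem fareyPairs_nonempty {Q : ℕ} (hQ : 0 < Q) : (fareyPairs Q).Nonempty := by
  rw [← Finset.card_pos, card_fareyPairs]
  exact totientSum_pos hQ

theorem fareyGap_lt {Q : ℕ} {p : Σ _ : ℕ, ℕ} (hp : p ∈ fareyPairs Q) : fareyGap Q p < p.1 := by
  have : NeZero p.1 := ⟨(mem_fareyPairs.1 hp).1.1.ne'⟩
  exact ZMod.val_lt _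

theorem fourier_natCast_div (q : ℕ) [NeZero q] (n : ℤ) (a : ℕ) :
    (fourier n (((a : ℝ) / q : ℝ) : UnitAddCircle) : ℂ) =
      ZMod.stdAddChar ((n : ZMod q) * (a : ZMod q)) := by
  have h : ((n : ZMod q) * (a : ZMod q)) = ((n * a : ℤ) : ZMod q) := by push_cast; rfl
  rw [h, ZMod.stdAddChar_coe, fourier_coe_apply]
  congr 1
  push_cast
  ring

/-- For fixed q, the third factor and the character value at n₁Q do not depend on a. What remains is
a character of n₀a + n₁a⁻¹ summed over units. -/
theorem norm_sum_fourier_le (Q q : ℕ) [NeZero q] (n : Fin 3 → ℤ) :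
    ‖∑ a ∈ (Finset.range q).filter q.Coprime, (fourier (n 0) (((a : ℝ) / q : ℝ) : UnitAddCircle) *
      (fourier (n 1) (((fareyGap Q ⟨q, a⟩ : ℕ) / q : ℝ) : UnitAddCircle) *
        fourier (n 2) (((q : ℝ) / Q : ℝ) : UnitAddCircle)) : ℂ)‖ ≤
      ‖kloostermanSum q (n 0) (n 1)‖ := by
  set c : ℂ := ZMod.stdAddChar ((n 1 : ZMod q) * (Q : ZMod q)) *
    fourier (n 2) (((q : ℝ) / Q : ℝ) : UnitAddCircle) with hc
  have h : ∀ a ∈ (Finset.range q).filter q.Coprime,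
      (fourier (n 0) (((a : ℝ) / q : ℝ) : UnitAddCircle) *
      (fourier (n 1) (((fareyGap Q ⟨q, a⟩ : ℕ) / q : ℝ) : UnitAddCircle) *
        fourier (n 2) (((q : ℝ) / Q : ℝ) : UnitAddCircle)) : ℂ) =
      c * ZMod.stdAddChar ((n 0 : ZMod q) * (a : ZMod q) + (n 1 : ZMod q) * (a : ZMod q)⁻¹) := by
    intro a _
    rw [fourier_natCast_div, fourier_natCast_div, fareyGap, ZMod.natCast_zmod_val, mul_add,
      AddChar.map_add_eq_mul, AddChar.map_add_eq_mul, hc]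
    ring
  rw [Finset.sum_congr rfl h, ← Finset.mul_sum, sum_filter_coprime_eq_sum_units q
    (fun x y => ZMod.stdAddChar ((n 0 : ZMod q) * x + (n 1 : ZMod q) * y)), ← kloostermanSum,
    norm_mul]
  have : ‖c‖ = 1 := by
    rw [hc, norm_mul, fourier_apply, Circle.norm_coe, ZMod.stdAddChar_apply, Circle.norm_coe,
      one_mul]
  rw [this, one_mul]

theorem exists_norm_kloostermanSum_le {m n : ℤ} (h : ¬(m = 0 ∧ n = 0)) :
    ∃ C : ℝ, ∀ (q : ℕ) [NeZero q], ‖kloostermanSum q m n‖ ≤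
      C * ((q : ℝ) ^ (3 / 4 : ℝ) * (q.divisors.card : ℝ)) := by
  by_cases hm : m = 0
  · have hn : n ≠ 0 := fun hn => h ⟨hm, hn⟩
    exact ⟨_, fun q _ => by rw [kloostermanSum_comm]; exact norm_kloostermanSum_le n hn _⟩
  · exact ⟨_, fun q _ => norm_kloostermanSum_le m hm _⟩

/-- The triple `(a / q, (Q - q') / q, q / Q)`, where `q'` is the denominator of the successor of
`a / q` in the Farey sequence of order `Q`. -/
noncomputable def fareyTriple (Q : ℕ) (p : Σ _ : ℕ, ℕ) : ℝ × ℝ × ℝ :=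
  ((p.2 : ℝ) / p.1, (fareyGap Q p : ℝ) / p.1, (p.1 : ℝ) / Q)

theorem tendsto_totientSum_inv_mul_sum :
    Tendsto (fun Q : ℕ => (totientSum Q : ℝ)⁻¹ * ∑ q ∈ Finset.Ioc 0 Q,
      (q : ℝ) ^ (3 / 4 : ℝ) * (q.divisors.card : ℝ)) atTop (𝓝 0) := by
  have hc : (3 / Real.pi ^ 2 : ℝ) ≠ 0 := by positivity
  have h := tendsto_sum_rpow_mul_card_divisors_div_sq.div tendsto_totientSum_div_sq hc
  rw [zero_div] at h
  refine h.congr' ?_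
  filter_upwards [eventually_gt_atTop 0] with Q hQ
  have h1 : (0 : ℝ) < Q := by exact_mod_cast hQ
  have h2 : (0 : ℝ) < totientSum Q := by exact_mod_cast totientSum_pos hQ
  simp only [Pi.div_apply]
  field_simp

/-- The Kloosterman bounds add up to o(Q²), while the number of fractions has order Q². -/
theorem tendsto_integral_mFourier_of_ne (n : Fin 3 → ℤ) (hn : ¬(n 0 = 0 ∧ n 1 = 0)) :
    Tendsto (fun Q : ℕ => ∫ z, UnitAddTorus.mFourier n z
      ∂(meanDirac (fareyPairs Q) fun p => toTorus (fareyTriple Q p))) atTop (𝓝 0) := by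
  obtain ⟨C, hC⟩ := exists_norm_kloostermanSum_le hn
  have h0 := tendsto_totientSum_inv_mul_sum.const_mul C
  rw [mul_zero] at h0
  refine squeeze_zero_norm (fun Q => ?_) h0
  rw [integral_meanDirac _ _ (UnitAddTorus.mFourier n).continuous.stronglyMeasurable, norm_smul,
    card_fareyPairs, norm_inv, Real.norm_natCast, ← mul_assoc, mul_comm C, mul_assoc]
  refine mul_le_mul_of_nonneg_left ?_ (by positivity)
  rw [fareyPairs, Finset.sum_sigma, Finset.mul_sum]
  refine norm_sum_le_of_le _ fun q hq => ?_
  have : NeZero q := ⟨(Finset.mem_Ioc.1 hq).1.ne'⟩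
  simp_rw [mFourier_toTorus, fareyTriple]
  exact (norm_sum_fourier_le Q q n).trans (hC q)

theorem totientSum_eq_card_filter (Q : ℕ) {t : ℝ} (h0 : 0 ≤ t) (h1 : t ≤ 1) (hQ : 0 < Q) :
    ((fareyPairs Q).filter fun p => (p.1 : ℝ) / Q ∈ Set.Iic t).card = totientSum ⌊t * Q⌋₊ := by
  have hQ' : (0 : ℝ) < Q := by exact_mod_cast hQ
  rw [← card_fareyPairs]
  congr 1
  ext p
  simp only [Finset.mem_filter, mem_fareyPairs, Set.mem_Iic, div_le_iff₀ hQ']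
  rw [Nat.le_floor_iff (by positivity)]
  constructor
  · rintro ⟨⟨⟨a, b⟩, c⟩, d⟩; exact ⟨⟨a, d⟩, c⟩
  · rintro ⟨⟨a, d⟩, c⟩
    refine ⟨⟨⟨a, ?_⟩, c⟩, d⟩
    have : (p.1 : ℝ) ≤ Q := d.trans (by nlinarith)
    exact_mod_cast this

/-- The distribution of the denominators, as a probability measure. -/
noncomputable def denominatorLaw (k : ℕ) : ProbabilityMeasure ℝ :=
  ⟨meanDirac (fareyPairs (k + 1)) fun p => (p.1 : ℝ) / (k + 1 : ℕ),
    isProbabilityMeasure_meanDirac (fareyPairs_nonempty k.succ_pos) _⟩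

/-- On [0, 1] the distribution function is a quotient of totient sums; outside, monotonicity and the
values at 0 and 1 decide. The order is k + 1, so that the laws are probability measures for every k.
-/
theorem tendsto_denominatorLaw_Iic (t : ℝ) :
    Tendsto (fun k => (denominatorLaw k : Measure ℝ).real (Set.Iic t)) atTop
      (𝓝 (linearDensity.real (Set.Iic t))) := by
  have hval : ∀ k s, 0 ≤ s → s ≤ 1 → (denominatorLaw k : Measure ℝ).real (Set.Iic s) =
      (totientSum ⌊s * (k + 1 : ℕ)⌋₊ : ℝ) / totientSum (k + 1) := by
    intro k s h0 h1
    rw [denominatorLaw, ProbabilityMeasure.coe_mk, measureReal_def,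
      meanDirac_apply _ _ measurableSet_Iic, ENNReal.toReal_div, card_fareyPairs,
      ← totientSum_eq_card_filter (k + 1) h0 h1 k.succ_pos]
    simp only [ENNReal.toReal_natCast]
    congr!
  have hlim : ∀ s : ℝ, 0 ≤ s → s ≤ 1 → linearDensity.real (Set.Iic s) = s ^ 2 := by
    intro s h0 h1
    rw [measureReal_def, linearDensity_Iic h0 h1, ENNReal.toReal_ofReal (sq_nonneg s)]
  rcases lt_or_ge t 0 with ht | ht
  · have h1 : linearDensity.real (Set.Iic t) = 0 := by
      refine le_antisymm ?_ measureReal_nonneg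
      refine (measureReal_mono (Set.Iic_subset_Iic.2 ht.le)).trans ?_
      simp [hlim]
    rw [h1]
    refine tendsto_const_nhds.congr fun k => ?_
    refine le_antisymm measureReal_nonneg ?_
    refine (measureReal_mono (Set.Iic_subset_Iic.2 ht.le)).trans ?_
    rw [hval k 0 le_rfl zero_le_one]
    simp [totientSum]
  rcases le_or_gt t 1 with ht1 | ht1
  · rw [hlim t ht ht1]
    refine (((tendsto_add_atTop_iff_nat 1).2 (tendsto_totientSum_floor_div ht))).congr fun k => ?_
    rw [hval k t ht ht1]
  · have h1 : linearDensity.real (Set.Iic t) = 1 := by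
      refine le_antisymm measureReal_le_one ?_
      refine le_trans ?_ (measureReal_mono (Set.Iic_subset_Iic.2 ht1.le))
      simp [hlim]
    rw [h1]
    refine tendsto_const_nhds.congr fun k => ?_
    refine le_antisymm ?_ measureReal_le_one
    refine le_trans ?_ (measureReal_mono (Set.Iic_subset_Iic.2 ht1.le))
    rw [hval k 1 zero_le_one le_rfl, one_mul, Nat.floor_natCast, div_self]
    exact_mod_cast (totientSum_pos k.succ_pos).ne'

/-- Half-open intervals form a π-system containing small neighbourhoods of each point, so
convergence on them implies weak convergence. -/
theorem tendsto_denominatorLaw :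
    Tendsto denominatorLaw atTop (𝓝 ⟨linearDensity, inferInstance⟩) := by
  refine IsPiSystem.tendsto_probabilityMeasure_of_tendsto_of_mem
    (S := {s | ∃ a b : ℝ, a ≤ b ∧ s = Set.Ioc a b}) ?_ ?_ ?_ ?_
  · rintro _ ⟨a, b, -, rfl⟩ _ ⟨c, d, -, rfl⟩ hne
    rw [Set.Ioc_inter_Ioc] at hne ⊢
    exact ⟨_, _, (Set.nonempty_Ioc.1 hne).le, rfl⟩
  · rintro _ ⟨a, b, -, rfl⟩
    exact measurableSet_Ioc
  · intro u hu x hx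
    obtain ⟨ε, hε, h⟩ := Metric.isOpen_iff.1 hu x hx
    refine ⟨Set.Ioc (x - ε / 2) (x + ε / 2), ⟨_, _, by linarith, rfl⟩,
      Ioc_mem_nhds (by linarith) (by linarith), fun y hy => h ?_⟩
    rw [Metric.mem_ball, Real.dist_eq, abs_lt]
    constructor <;> linarith [hy.1, hy.2]
  · rintro _ ⟨a, b, hab, rfl⟩
    rw [← NNReal.tendsto_coe]
    have h : ∀ μ : ProbabilityMeasure ℝ, ((μ (Set.Ioc a b) : ℝ≥0) : ℝ) =
        (μ : Measure ℝ).real (Set.Iic b) - (μ : Measure ℝ).real (Set.Iic a) := by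
      intro μ
      rw [← measureReal_sdiff (Set.Iic_subset_Iic.2 hab) measurableSet_Iic, Set.Iic_sdiff_Iic]
      rfl
    refine Tendsto.congr (fun k => (h (denominatorLaw k)).symm) ?_
    rw [h ⟨linearDensity, inferInstance⟩]
    exact (tendsto_denominatorLaw_Iic b).sub (tendsto_denominatorLaw_Iic a)

/-- The distribution of the triples `fareyTriple` on the torus. -/
noncomputable def torusLaw (k : ℕ) : ProbabilityMeasure (UnitAddTorus (Fin 3)) :=
  ⟨meanDirac (fareyPairs (k + 1)) fun p => toTorus (fareyTriple (k + 1) p),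
    isProbabilityMeasure_meanDirac (fareyPairs_nonempty k.succ_pos) _⟩

theorem tendsto_integral_complex {μ : ℕ → ProbabilityMeasure ℝ} {ν : ProbabilityMeasure ℝ}
    (h : Tendsto μ atTop (𝓝 ν)) (f : ℝ → ℂ) (hf : Continuous f) (C : ℝ) (hC : ∀ x, ‖f x‖ ≤ C) :
    Tendsto (fun k => ∫ x, f x ∂(μ k : Measure ℝ)) atTop (𝓝 (∫ x, f x ∂(ν : Measure ℝ))) := by
  rw [ProbabilityMeasure.tendsto_iff_forall_integral_tendsto] at h
  have hint : ∀ κ : ProbabilityMeasure ℝ, Integrable f (κ : Measure ℝ) := fun κ =>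
    Integrable.of_bound hf.aestronglyMeasurable C (Eventually.of_forall hC)
  have key : ∀ κ : ProbabilityMeasure ℝ, ∫ x, f x ∂(κ : Measure ℝ) =
      ((∫ x, (f x).re ∂(κ : Measure ℝ) : ℝ) : ℂ) +
        ((∫ x, (f x).im ∂(κ : Measure ℝ) : ℝ) : ℂ) * Complex.I := fun κ =>
    (integral_re_add_im (hint κ)).symm
  simp_rw [key]
  have h1 := h (BoundedContinuousFunction.ofNormedAddCommGroup (fun x => (f x).re)
    (Complex.continuous_re.comp hf) C fun x => (Complex.abs_re_le_norm _).trans (hC x))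
  have h2 := h (BoundedContinuousFunction.ofNormedAddCommGroup (fun x => (f x).im)
    (Complex.continuous_im.comp hf) C fun x => (Complex.abs_im_le_norm _).trans (hC x))
  exact ((Complex.continuous_ofReal.tendsto _).comp h1).add
    (((Complex.continuous_ofReal.tendsto _).comp h2).mul_const _)

theorem tendsto_torusLaw : Tendsto torusLaw atTop (𝓝 ⟨torusLimit, inferInstance⟩) := by
  refine tendsto_of_forall_integral_mFourier fun n => ?_
  simp only [ProbabilityMeasure.coe_mk]
  rw [integral_mFourier_torusLimit]
  split_ifs with h
  · have hcont : Continuous fun x : ℝ => (fourier (n 2) (x : UnitAddCircle) : ℂ) :=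
      (fourier (n 2)).continuous.comp (AddCircle.continuous_mk' 1)
    have h1 := tendsto_integral_complex tendsto_denominatorLaw _ hcont 1 fun x => by
      rw [fourier_apply, Circle.norm_coe]
    refine h1.congr fun k => ?_
    rw [denominatorLaw, torusLaw, ProbabilityMeasure.coe_mk, ProbabilityMeasure.coe_mk,
      integral_meanDirac _ _ hcont.stronglyMeasurable,
      integral_meanDirac _ _ (UnitAddTorus.mFourier n).continuous.stronglyMeasurable]
    congr 1
    refine Finset.sum_congr rfl fun p _ => ?_
    rw [mFourier_toTorus, h.1, h.2]
    simp [fareyTriple]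
  · exact (tendsto_add_atTop_iff_nat 1).2 (tendsto_integral_mFourier_of_ne n h)

end Equidistribution

/-! ### From the torus back to the Farey triangle. -/

/-- The denominator of the successor of `a / q` in the Farey sequence of order `Q`. -/
noncomputable def nextDen (Q : ℕ) (p : Σ _ : ℕ, ℕ) : ℕ := Q - fareyGap Q p

/-- The fraction `a / q` together with the normalized denominators of it and its successor. -/
noncomputable def fareyPoint (Q : ℕ) (p : Σ _ : ℕ, ℕ) : ℝ × ℝ × ℝ :=
  ((p.2 : ℝ) / p.1, (p.1 : ℝ) / Q, (nextDen Q p : ℝ) / Q)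

/-- The distribution of the points `fareyPoint`. -/
noncomputable def fareyLaw (k : ℕ) : ProbabilityMeasure (ℝ × ℝ × ℝ) :=
  ⟨meanDirac (fareyPairs (k + 1)) (fareyPoint (k + 1)),
    isProbabilityMeasure_meanDirac (fareyPairs_nonempty k.succ_pos) _⟩

/-- The limit of the distributions of the points `fareyPoint`. -/
noncomputable def fareyLimit : Measure (ℝ × ℝ × ℝ) :=
  (volume.restrict (Set.Ico (0 : ℝ) 1)).prod ((2 : ℝ≥0∞) • volume.restrict fareyTriangle)

instance isProbabilityMeasure_fareyLimit : IsProbabilityMeasure fareyLimit := by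
  unfold fareyLimit
  infer_instance

/-- `fareyLimit` as a bundled probability measure. -/
noncomputable def fareyLimitLaw : ProbabilityMeasure (ℝ × ℝ × ℝ) := ⟨fareyLimit, inferInstance⟩

section Equidistribution

/-- The representative in `[0, 1)` of a point of the circle. -/
noncomputable def circleIco (z : UnitAddCircle) : ℝ := AddCircle.equivIco 1 0 z

/-- The representative in `(0, 1]` of a point of the circle. -/
noncomputable def circleIoc (z : UnitAddCircle) : ℝ := AddCircle.equivIoc 1 0 z

theorem circleIco_coe {x : ℝ} (hx : x ∈ Set.Ico (0 : ℝ) 1) : circleIco (x : UnitAddCircle) = x := by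
  rw [circleIco, AddCircle.equivIco_coe_eq (by simpa using hx)]

theorem circleIoc_coe {x : ℝ} (hx : x ∈ Set.Ioc (0 : ℝ) 1) : circleIoc (x : UnitAddCircle) = x := by
  rw [circleIoc, AddCircle.equivIoc_coe_of_mem (by simpa using hx)]

theorem measurable_circleIco : Measurable circleIco :=
  measurable_subtype_coe.comp (AddCircle.measurableEquivIco 1 0).measurable

theorem measurable_circleIoc : Measurable circleIoc :=
  measurable_subtype_coe.comp (AddCircle.measurableEquivIoc 1 0).measurable

theorem continuousAt_circleIco {z : UnitAddCircle} (hz : z ≠ 0) : ContinuousAt circleIco z :=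
  continuousAt_subtype_val.comp (AddCircle.continuousAt_equivIco 1 0 (by simpa using hz))

theorem continuousAt_circleIoc {z : UnitAddCircle} (hz : z ≠ 0) : ContinuousAt circleIoc z :=
  continuousAt_subtype_val.comp (AddCircle.continuousAt_equivIoc 1 0 (by simpa using hz))

/-- The inverse of `(α, x, y) ↦ (α, (1 - y) / x, x)`, on the torus. -/
noncomputable def ofTorus (z : UnitAddTorus (Fin 3)) : ℝ × ℝ × ℝ :=
  (circleIco (z 0), circleIoc (z 2), 1 - circleIoc (z 2) * circleIco (z 1))

theorem measurable_ofTorus : Measurable ofTorus := by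
  have h0 : Measurable fun z : UnitAddTorus (Fin 3) => circleIco (z 0) :=
    measurable_circleIco.comp (measurable_pi_apply 0)
  have h1 : Measurable fun z : UnitAddTorus (Fin 3) => circleIco (z 1) :=
    measurable_circleIco.comp (measurable_pi_apply 1)
  have h2 : Measurable fun z : UnitAddTorus (Fin 3) => circleIoc (z 2) :=
    measurable_circleIoc.comp (measurable_pi_apply 2)
  exact h0.prodMk (h2.prodMk (measurable_const.sub (h2.mul h1)))

/-- The excluded points, where a representative jumps between 0 and 1, are null for `torusLimit`.
The choice of (0, 1] for the last coordinate matters because q/Q attains 1 but never 0. -/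
theorem continuousAt_ofTorus {z : UnitAddTorus (Fin 3)} (h0 : z 0 ≠ 0) (h1 : z 1 ≠ 0)
    (h2 : z 2 ≠ 0) : ContinuousAt ofTorus z := by
  have c0 : ContinuousAt (fun z : UnitAddTorus (Fin 3) => circleIco (z 0)) z :=
    ContinuousAt.comp (f := fun z : UnitAddTorus (Fin 3) => z 0) (continuousAt_circleIco h0)
      (continuous_apply 0).continuousAt
  have c1 : ContinuousAt (fun z : UnitAddTorus (Fin 3) => circleIco (z 1)) z :=
    ContinuousAt.comp (f := fun z : UnitAddTorus (Fin 3) => z 1) (continuousAt_circleIco h1)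
      (continuous_apply 1).continuousAt
  have c2 : ContinuousAt (fun z : UnitAddTorus (Fin 3) => circleIoc (z 2)) z :=
    ContinuousAt.comp (f := fun z : UnitAddTorus (Fin 3) => z 2) (continuousAt_circleIoc h2)
      (continuous_apply 2).continuousAt
  exact c0.prodMk (c2.prodMk (continuousAt_const.sub (c2.mul c1)))

theorem ofTorus_toTorus {w : ℝ × ℝ × ℝ} (h0 : w.1 ∈ Set.Ico (0 : ℝ) 1)
    (h1 : w.2.1 ∈ Set.Ico (0 : ℝ) 1) (h2 : w.2.2 ∈ Set.Ioc (0 : ℝ) 1) :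
    ofTorus (toTorus w) = (w.1, w.2.2, 1 - w.2.2 * w.2.1) := by
  simp only [ofTorus, toTorus, Matrix.cons_val_zero, Matrix.cons_val_one, Matrix.cons_val]
  rw [circleIco_coe h0, circleIco_coe h1, circleIoc_coe h2]

theorem ofTorus_fareyTriple {Q : ℕ} {p : Σ _ : ℕ, ℕ} (hp : p ∈ fareyPairs Q) :
    ofTorus (toTorus (fareyTriple Q p)) = fareyPoint Q p := by
  obtain ⟨⟨h1, h2⟩, h3, h4⟩ := mem_fareyPairs.1 hp
  have hg := fareyGap_lt hp
  have hq : (0 : ℝ) < p.1 := by exact_mod_cast h1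
  have hQ : (0 : ℝ) < Q := by exact_mod_cast h1.trans_le h2
  have h3' : (p.2 : ℝ) < p.1 := by exact_mod_cast h3
  have hg' : (fareyGap Q p : ℝ) < p.1 := by exact_mod_cast hg
  have h2' : (p.1 : ℝ) ≤ Q := by exact_mod_cast h2
  rw [ofTorus_toTorus]
  · simp only [fareyTriple, fareyPoint, nextDen]
    rw [Nat.cast_sub (hg.le.trans h2)]
    congr 2
    field_simp
  · exact ⟨by simp only [fareyTriple]; positivity, (div_lt_one hq).2 h3'⟩
  · exact ⟨by simp only [fareyTriple]; positivity, (div_lt_one hq).2 hg'⟩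
  · exact ⟨by simp only [fareyTriple]; positivity, (div_le_one hQ).2 h2'⟩

theorem ae_mem_box : ∀ᵐ w : ℝ × ℝ × ℝ ∂((volume.restrict (Set.Ico (0 : ℝ) 1)).prod
    ((volume.restrict (Set.Ico (0 : ℝ) 1)).prod linearDensity)),
    (w.1 ∈ Set.Ico (0 : ℝ) 1 ∧ w.1 ≠ 0) ∧ (w.2.1 ∈ Set.Ico (0 : ℝ) 1 ∧ w.2.1 ≠ 0) ∧
      (w.2.2 ∈ Set.Ioc (0 : ℝ) 1 ∧ w.2.2 ≠ 1) := by
  have hU : ∀ᵐ x ∂(volume.restrict (Set.Ico (0 : ℝ) 1)), x ∈ Set.Ico (0 : ℝ) 1 ∧ x ≠ 0 := by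
    filter_upwards [ae_restrict_mem measurableSet_Ico, Measure.ae_ne _ (0 : ℝ)] with x h1 h2
    exact ⟨h1, h2⟩
  have hL : ∀ᵐ x ∂linearDensity, x ∈ Set.Ioc (0 : ℝ) 1 ∧ x ≠ 1 := by
    have h1 : ∀ᵐ x ∂linearDensity, x ∈ Set.Ioc (0 : ℝ) 1 := by
      rw [ae_iff]
      exact linearDensity_compl_Ioc
    filter_upwards [h1, linearDensity_absolutelyContinuous.ae_le (Measure.ae_ne _ (1 : ℝ))]
      with x h1 h2
    exact ⟨h1, h2⟩
  have h2 : ∀ᵐ w ∂((volume.restrict (Set.Ico (0 : ℝ) 1)).prod linearDensity),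
      (w.1 ∈ Set.Ico (0 : ℝ) 1 ∧ w.1 ≠ 0) ∧ (w.2 ∈ Set.Ioc (0 : ℝ) 1 ∧ w.2 ≠ 1) :=
    (Measure.quasiMeasurePreserving_fst.ae hU).and (Measure.quasiMeasurePreserving_snd.ae hL)
  exact (Measure.quasiMeasurePreserving_fst.ae hU).and (Measure.quasiMeasurePreserving_snd.ae h2)

theorem map_ofTorus_torusLimit : torusLimit.map ofTorus = fareyLimit := by
  rw [torusLimit, Measure.map_map measurable_ofTorus continuous_toTorus.measurable, fareyLimit,
    ← map_linearDensity]
  have h1 := Measure.map_prod_map (volume.restrict (Set.Ico (0 : ℝ) 1))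
    ((volume.restrict (Set.Ico (0 : ℝ) 1)).prod linearDensity) measurable_id
    (by fun_prop : Measurable (fun w : ℝ × ℝ => (w.2, 1 - w.2 * w.1)))
  rw [Measure.map_id] at h1
  rw [h1]
  refine Measure.map_congr ?_
  filter_upwards [ae_mem_box] with w hw
  exact ofTorus_toTorus hw.1.1 hw.2.1.1 hw.2.2.1

theorem ae_continuousAt_ofTorus : ∀ᵐ z ∂torusLimit, ContinuousAt ofTorus z := by
  have hne : ∀ x : ℝ, x ∈ Set.Ico (0 : ℝ) 1 → x ≠ 0 → (x : UnitAddCircle) ≠ 0 := by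
    intro x hx h0 h
    apply h0
    rw [← circleIco_coe hx, h, ← AddCircle.coe_zero, circleIco_coe (by simp)]
  have h : ∀ᵐ z ∂torusLimit, z 0 ≠ 0 ∧ z 1 ≠ 0 ∧ z 2 ≠ 0 := by
    rw [torusLimit, ae_map_iff continuous_toTorus.measurable.aemeasurable]
    · filter_upwards [ae_mem_box] with w hw
      refine ⟨hne _ hw.1.1 hw.1.2, hne _ hw.2.1.1 hw.2.1.2, hne _ ⟨hw.2.2.1.1.le, ?_⟩ hw.2.2.1.1.ne'⟩
      exact lt_of_le_of_ne hw.2.2.1.2 hw.2.2.2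
    · have : ∀ i : Fin 3, MeasurableSet {z : UnitAddTorus (Fin 3) | z i ≠ 0} := fun i =>
        (measurableSet_singleton (0 : UnitAddCircle)).compl.preimage (measurable_pi_apply i)
      exact (this 0).inter ((this 1).inter (this 2))
  filter_upwards [h] with z hz
  exact continuousAt_ofTorus hz.1 hz.2.1 hz.2.2

theorem tendsto_fareyLaw : Tendsto fareyLaw atTop (𝓝 fareyLimitLaw) := by
  refine tendsto_of_forall_isOpen_le_liminf' fun G hG => ?_
  have h := le_liminf_measure_preimage_of_tendsto tendsto_torusLaw
    (φ := fun _ => ofTorus) (ψ := ofTorus) (by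
      filter_upwards [ae_continuousAt_ofTorus] with z hz
      exact hz.tendsto.comp tendsto_snd) hG
  simp only [fareyLimitLaw, ProbabilityMeasure.coe_mk] at h ⊢
  rw [← map_ofTorus_torusLimit, Measure.map_apply measurable_ofTorus hG.measurableSet]
  refine h.trans (le_of_eq ?_)
  congr 1
  ext k
  classical
  rw [torusLaw, fareyLaw, ProbabilityMeasure.coe_mk, ProbabilityMeasure.coe_mk,
    meanDirac_apply _ _ (measurable_ofTorus hG.measurableSet), meanDirac_apply _ _ hG.measurableSet]
  congr 2
  refine congrArg _ (Finset.filter_congr fun p hp => ?_)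
  rw [Set.mem_preimage, ofTorus_fareyTriple hp]

end Equidistribution

/-! ### Consecutive Farey fractions and their denominators. -/

/-- The increasing enumeration of the Farey fractions of order `Q` in `I`. -/
noncomputable def fareyEnum (Q : ℕ) (I : Set ℝ) : Fin (fareyCount Q I) ↪o ℝ :=
  (fareyIn Q I).orderEmbOfFin rfl

section FareyNeighbours

theorem fareyEnum_mem (Q : ℕ) (I : Set ℝ) (j : Fin (fareyCount Q I)) :
    fareyEnum Q I j ∈ fareyIn Q I :=
  Finset.orderEmbOfFin_mem _ _ _

theorem exists_fareyEnum_eq {Q : ℕ} {I : Set ℝ} {x : ℝ} (hx : x ∈ fareyIn Q I) :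
    ∃ j, fareyEnum Q I j = x := by
  have h : x ∈ Set.range ((fareyIn Q I).orderEmbOfFin rfl) := by
    rw [Finset.range_orderEmbOfFin]; exact hx
  exact h


theorem coprime_div_injective {a q b s : ℕ} (hq : 0 < q) (hs : 0 < s) (h1 : q.Coprime a)
    (h2 : s.Coprime b) (h : (a : ℝ) / q = (b : ℝ) / s) : a = b ∧ q = s := by
  have hq' : (q : ℝ) ≠ 0 := by exact_mod_cast hq.ne'
  have hs' : (s : ℝ) ≠ 0 := by exact_mod_cast hs.ne'
  rw [div_eq_div_iff hq' hs'] at h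
  have h3 : a * s = b * q := by exact_mod_cast h
  have h4 : q = s := Nat.dvd_antisymm (h1.dvd_of_dvd_mul_left ⟨b, by rw [h3]; ring⟩)
    (h2.dvd_of_dvd_mul_left ⟨a, by rw [← h3]; ring⟩)
  subst h4
  exact ⟨Nat.eq_of_mul_eq_mul_right hq h3, rfl⟩

theorem mem_farey {Q : ℕ} {x : ℝ} : x ∈ farey Q ↔
    ∃ a q : ℕ, 0 < q ∧ q ≤ Q ∧ a ≤ q ∧ q.Coprime a ∧ x = (a : ℝ) / q := by
  simp only [farey, Finset.mem_image, Finset.mem_filter, Finset.mem_product, Finset.mem_Icc,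
    Finset.mem_range, Prod.exists]
  constructor
  · rintro ⟨q, a, ⟨⟨⟨h1, h2⟩, -⟩, h3, h4⟩, rfl⟩
    exact ⟨a, q, h1, h2, h3, h4.symm, rfl⟩
  · rintro ⟨a, q, h1, h2, h3, h4, rfl⟩
    exact ⟨q, a, ⟨⟨⟨h1, h2⟩, by omega⟩, h3, h4.symm⟩, rfl⟩

/-- Subtracting the residue of Q + a⁻¹ mod q from Q leaves the integer q' in (Q - q, Q] with q' ≡
-a⁻¹ mod q. Then q divides a q' + 1, and the quotient b is the numerator of the successor. -/
theorem nextDen_spec {Q : ℕ} {p : Σ _ : ℕ, ℕ} (hp : p ∈ fareyPairs Q) :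
    0 < nextDen Q p ∧ nextDen Q p ≤ Q ∧ Q < p.1 + nextDen Q p ∧
      ∃ b, b * p.1 = p.2 * nextDen Q p + 1 ∧ b ≤ nextDen Q p := by
  obtain ⟨⟨h1, h2⟩, h3, h4⟩ := mem_fareyPairs.1 hp
  have hg := fareyGap_lt hp
  have hs : 0 < nextDen Q p := by unfold nextDen; omega
  refine ⟨hs, by unfold nextDen; omega, by unfold nextDen; omega, ?_⟩
  have hdvd : p.1 ∣ p.2 * nextDen Q p + 1 := by
    have : NeZero p.1 := ⟨h1.ne'⟩
    rw [← ZMod.natCast_eq_zero_iff]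
    have h5 : (nextDen Q p : ZMod p.1) = Q - ((Q : ZMod p.1) + (p.2 : ZMod p.1)⁻¹) := by
      rw [nextDen, Nat.cast_sub (hg.le.trans h2), fareyGap, ZMod.natCast_zmod_val]
    push_cast
    rw [h5]
    have h6 := ZMod.coe_mul_inv_eq_one p.2 h4.symm
    linear_combination -h6
  obtain ⟨b, hb⟩ := hdvd
  refine ⟨b, by rw [hb, mul_comm], ?_⟩
  have h7 : p.1 * b ≤ p.1 * nextDen Q p := by
    rw [← hb]
    have : (p.2 + 1) * nextDen Q p ≤ p.1 * nextDen Q p := Nat.mul_le_mul_right _ h3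
    nlinarith
  exact Nat.le_of_mul_le_mul_left h7 h1

theorem div_le_div_of_farey_neighbours {Q a q b s c d : ℕ} (hq : 0 < q) (hs : 0 < s) (hd : 0 < d)
    (hdet : b * q = a * s + 1) (hQ : Q < q + s) (hdQ : d ≤ Q)
    (h : (a : ℝ) / q < (c : ℝ) / d) : (b : ℝ) / s ≤ (c : ℝ) / d := by
  have hq' : (0 : ℝ) < q := by exact_mod_cast hq
  have hs' : (0 : ℝ) < s := by exact_mod_cast hs
  have hd' : (0 : ℝ) < d := by exact_mod_cast hd
  rw [div_lt_div_iff₀ hq' hd'] at h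
  by_contra! hlt
  rw [div_lt_div_iff₀ hd' hs'] at hlt
  have h1 : (a : ℤ) * d + 1 ≤ c * q := by exact_mod_cast h
  have h2 : (c : ℤ) * s + 1 ≤ b * d := by exact_mod_cast hlt
  have h3 : (b : ℤ) * q = a * s + 1 := by exact_mod_cast hdet
  -- For c/d strictly between the neighbours both brackets are at least 1, so d ≥ q + s > Q.
  have h4 : (d : ℤ) = q * (b * d - c * s) + s * (c * q - a * d) := by
    linear_combination (-(d : ℤ)) * h3
  have h5 : (q : ℤ) + s ≤ d := by
    have e1 : (q : ℤ) * 1 ≤ q * (b * d - c * s) :=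
      mul_le_mul_of_nonneg_left (by linarith) (by positivity)
    have e2 : (s : ℤ) * 1 ≤ s * (c * q - a * d) :=
      mul_le_mul_of_nonneg_left (by linarith) (by positivity)
    linarith
  omega

theorem mem_fareyIn {Q : ℕ} {I : Set ℝ} {x : ℝ} : x ∈ fareyIn Q I ↔ x ∈ farey Q ∧ x ∈ I := by
  classical
  simp [fareyIn]

/-- The fraction built from `nextDen` lies above a/q and at or below b/s, hence in I because I is
order-connected. As nothing is enumerated between indices j and j + 1, it equals b/s. -/
theorem fareyEnum_succ_spec {Q : ℕ} {I : Set ℝ} (hI : I.OrdConnected)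
    {j k : Fin (fareyCount Q I)} (hk : (k : ℕ) = j + 1) {a q b s : ℕ} (hq : 0 < q) (hqQ : q ≤ Q)
    (haq : q.Coprime a) (hs : 0 < s) (hsQ : s ≤ Q) (hbs : b ≤ s) (hcop : s.Coprime b)
    (hj : fareyEnum Q I j = (a : ℝ) / q)
    (hk' : fareyEnum Q I k = (b : ℝ) / s) :
    (⟨q, a⟩ : Σ _ : ℕ, ℕ) ∈ fareyPairs Q ∧ s = nextDen Q ⟨q, a⟩ ∧ b * q = a * s + 1 := by
  have hq' : (0 : ℝ) < q := by exact_mod_cast hq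
  have hs' : (0 : ℝ) < s := by exact_mod_cast hs
  have hlt : (a : ℝ) / q < (b : ℝ) / s := by
    rw [← hj, ← hk']
    exact (fareyEnum Q I).strictMono (by rw [Fin.lt_def]; omega)
  have hb1 : (b : ℝ) / s ≤ 1 := by
    rw [div_le_one hs']
    exact_mod_cast hbs
  have haq' : a < q := by
    have := (div_lt_one hq').1 (hlt.trans_le hb1)
    exact_mod_cast this
  have hp : (⟨q, a⟩ : Σ _ : ℕ, ℕ) ∈ fareyPairs Q := mem_fareyPairs.2 ⟨⟨hq, hqQ⟩, haq', haq⟩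
  obtain ⟨h1, h2, h3, b', h4, h5⟩ := nextDen_spec hp
  set s' := nextDen Q ⟨q, a⟩ with hs'def
  simp only at h3 h4
  have hs'' : (0 : ℝ) < s' := by exact_mod_cast h1
  have hcop' : s'.Coprime b' := by
    rw [Nat.coprime_iff_gcd_eq_one, ← Nat.dvd_one,
      ← Nat.dvd_add_right (Dvd.dvd.mul_left (Nat.gcd_dvd_left s' b') a), ← h4]
    exact Dvd.dvd.mul_right (Nat.gcd_dvd_right s' b') q
  have hle : (b' : ℝ) / s' ≤ (b : ℝ) / s := div_le_div_of_farey_neighbours hq h1 hs h4 h3 hsQ hlt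
  have hlt' : (a : ℝ) / q < (b' : ℝ) / s' := by
    rw [div_lt_div_iff₀ hq' hs'']
    have : a * s' < b' * q := by omega
    exact_mod_cast this
  have hmem : (b' : ℝ) / s' ∈ fareyIn Q I := by
    refine mem_fareyIn.2 ⟨mem_farey.2 ⟨b', s', h1, h2, h5, hcop', rfl⟩, ?_⟩
    refine hI.out ?_ ?_ ⟨hlt'.le, hle⟩
    · rw [← hj]; exact (mem_fareyIn.1 (fareyEnum_mem Q I j)).2
    · rw [← hk']; exact (mem_fareyIn.1 (fareyEnum_mem Q I k)).2
  obtain ⟨i, hi⟩ := exists_fareyEnum_eq hmem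
  have hji : j < i := by
    rw [← (fareyEnum Q I).lt_iff_lt, hi, hj]; exact hlt'
  have hik : i ≤ k := by
    rw [← (fareyEnum Q I).le_iff_le, hi, hk']; exact hle
  have hik' : i = k := by
    rw [Fin.lt_def] at hji
    rw [Fin.le_def] at hik
    exact Fin.ext (by omega)
  rw [hik', hk'] at hi
  obtain ⟨rfl, hss⟩ := coprime_div_injective hs h1 hcop hcop' hi
  exact ⟨hp, hss, by rw [hss]; exact h4⟩

/-- The conditions d₂ ≤ Q < d₁ + d₂ say exactly k d₁ ≤ Q + d₀ < (k + 1) d₁. -/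
theorem fareyK_of_denominators {Q k d₀ d₁ d₂ n : ℕ} {p : ℝ × ℝ} (hQ : 0 < Q) (h₁ : 0 < d₁)
    (hk : d₀ + d₂ = k * d₁) (hle : d₂ ≤ Q) (hlt : Q < d₁ + d₂)
    (hL₀ : fareyL n p = (d₀ : ℝ) / Q) (hL₁ : fareyL (n + 1) p = (d₁ : ℝ) / Q) :
    fareyK n p = k := by
  have hQ' : (0 : ℝ) < Q := by exact_mod_cast hQ
  have h₁' : (0 : ℝ) < d₁ := by exact_mod_cast h₁
  have hk' : (d₀ : ℝ) + d₂ = k * d₁ := by exact_mod_cast hk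
  have hle' : (d₂ : ℝ) ≤ Q := by exact_mod_cast hle
  have hlt' : (Q : ℝ) < d₁ + d₂ := by exact_mod_cast hlt
  have e : (1 + (d₀ : ℝ) / Q) / (d₁ / Q) = (Q + d₀) / d₁ := by field_simp
  rw [fareyK, hL₀, hL₁, e, Int.floor_eq_iff]
  push_cast
  rw [le_div_iff₀ h₁', div_lt_iff₀ h₁']
  constructor <;> linarith

theorem fareyL_add_two (n : ℕ) (p : ℝ × ℝ) :
    fareyL (n + 2) p = fareyK n p * fareyL (n + 1) p - fareyL n p := by
  rw [fareyL, fareyK]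

theorem fareyL_of_denominators {Q M : ℕ} (hQ : 0 < Q) {d : ℕ → ℕ} (hpos : ∀ i ≤ M, 0 < d i)
    (hstep : ∀ i, i + 2 ≤ M → (∃ k, d i + d (i + 2) = k * d (i + 1)) ∧ d (i + 2) ≤ Q ∧
      Q < d (i + 1) + d (i + 2)) (i : ℕ) (hi : i + 1 ≤ M) :
    fareyL i ((d 0 : ℝ) / Q, (d 1 : ℝ) / Q) = (d i : ℝ) / Q ∧
      fareyL (i + 1) ((d 0 : ℝ) / Q, (d 1 : ℝ) / Q) = (d (i + 1) : ℝ) / Q := by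
  induction i with
  | zero => simp [fareyL]
  | succ i ih =>
    obtain ⟨h0, h1⟩ := ih (by omega)
    obtain ⟨⟨k, hk⟩, hle, hlt⟩ := hstep i (by omega)
    refine ⟨h1, ?_⟩
    rw [fareyL_add_two, fareyK_of_denominators hQ (hpos _ (by omega)) hk hle hlt h0 h1, h0, h1]
    have hk' : (d i : ℝ) + d (i + 2) = k * d (i + 1) := by exact_mod_cast hk
    push_cast
    linear_combination -hk' / Q

/-- The gaps between alternate Farey fractions in an interval, in terms of the maps `fareyL`. -/
theorem fareyEnum_gap {Q h : ℕ} {I : Set ℝ} (hI : I.OrdConnected)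
    {j : Fin (fareyCount Q I)} (hjN : (j : ℕ) < fareyCount Q I - h - 1) {a q : ℕ} (hq : 0 < q)
    (hqQ : q ≤ Q) (haq : q.Coprime a)
    (hj : fareyEnum Q I j = (a : ℝ) / q) (i : Fin h) :
    fareyEnum Q I ⟨(j : ℕ) + i + 2, by omega⟩ -
      fareyEnum Q I ⟨(j : ℕ) + i, by omega⟩ =
      ((fareyK i (fareyPoint Q ⟨q, a⟩).2 : ℝ) / (fareyL i (fareyPoint Q ⟨q, a⟩).2 *
        fareyL (i + 2) (fareyPoint Q ⟨q, a⟩).2)) / (Q : ℝ) ^ 2 := by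
  have hQ : 0 < Q := hq.trans_le hqQ
  set γ := fareyEnum Q I with hγ
  -- Numerators and denominators become sequences on all of ℕ, with junk values past h + 1, to avoid
  -- dependent indices.
  have hex : ∀ i : ℕ, ∃ bs : ℕ × ℕ, i ≤ h + 1 → 0 < bs.2 ∧ bs.2 ≤ Q ∧ bs.1 ≤ bs.2 ∧
      bs.2.Coprime bs.1 ∧ ∀ hi : (j : ℕ) + i < fareyCount Q I,
        γ ⟨(j : ℕ) + i, hi⟩ = (bs.1 : ℝ) / bs.2 := by
    intro i
    by_cases hi : i ≤ h + 1
    · have hi' : (j : ℕ) + i < fareyCount Q I := by omega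
      obtain ⟨b, s, h1, h2, h3, h4, h5⟩ :=
        mem_farey.1 (mem_fareyIn.1 (fareyEnum_mem Q I ⟨(j : ℕ) + i, hi'⟩)).1
      exact ⟨(b, s), fun _ => ⟨h1, h2, h3, h4, fun _ => h5⟩⟩
    · exact ⟨(0, 0), fun h => absurd h hi⟩
  choose f hf using hex
  set b : ℕ → ℕ := fun i => (f i).1 with hb
  set d : ℕ → ℕ := fun i => (f i).2 with hd
  have hpos : ∀ i ≤ h + 1, 0 < d i := fun i hi => (hf i hi).1
  have hdQ : ∀ i ≤ h + 1, d i ≤ Q := fun i hi => (hf i hi).2.1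
  have hbd : ∀ i ≤ h + 1, b i ≤ d i := fun i hi => (hf i hi).2.2.1
  have hcop : ∀ i ≤ h + 1, (d i).Coprime (b i) := fun i hi => (hf i hi).2.2.2.1
  have hval : ∀ i (_ : i ≤ h + 1) (hi' : (j : ℕ) + i < fareyCount Q I),
      γ ⟨(j : ℕ) + i, hi'⟩ = (b i : ℝ) / d i := fun i hi => (hf i hi).2.2.2.2
  have hnext : ∀ i, i + 1 ≤ h + 1 → (⟨d i, b i⟩ : Σ _ : ℕ, ℕ) ∈ fareyPairs Q ∧
      d (i + 1) = nextDen Q ⟨d i, b i⟩ ∧ b (i + 1) * d i = b i * d (i + 1) + 1 := by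
    intro i hi
    exact fareyEnum_succ_spec hI (j := ⟨(j : ℕ) + i, by omega⟩)
      (k := ⟨(j : ℕ) + (i + 1), by omega⟩) (by simp; omega) (hpos i (by omega))
      (hdQ i (by omega)) (hcop i (by omega)) (hpos _ hi) (hdQ _ hi) (hbd _ hi) (hcop _ hi)
      (hval i (by omega) _) (hval (i + 1) hi _)
  have h00 := hval 0 (by omega) (by simp)
  obtain ⟨ha0, hq0⟩ : a = b 0 ∧ q = d 0 := by
    refine coprime_div_injective hq (hpos 0 (by omega)) haq (hcop 0 (by omega)) ?_
    rw [← h00, ← hj]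
    rfl
  have hpt : (fareyPoint Q ⟨q, a⟩).2 = ((d 0 : ℝ) / Q, (d 1 : ℝ) / Q) := by
    rw [(hnext 0 (by omega)).2.1, fareyPoint, ha0, hq0]
  have hstep : ∀ i, i + 2 ≤ h + 1 → (∃ k, d i + d (i + 2) = k * d (i + 1)) ∧ d (i + 2) ≤ Q ∧
      Q < d (i + 1) + d (i + 2) := by
    intro i hi
    obtain ⟨-, -, e1⟩ := hnext i (by omega)
    obtain ⟨m2, e3, e2⟩ := hnext (i + 1) (by omega)
    refine ⟨?_, hdQ _ hi, ?_⟩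
    -- Subtracting the two determinant identities gives b₁(d₀ + d₂) = d₁(b₀ + b₂), and b₁ is coprime
    -- to d₁.
    · have hdvd : d (i + 1) ∣ b (i + 1) * (d i + d (i + 2)) :=
        ⟨b i + b (i + 2), by
          have e2' : b (i + 2) * d (i + 1) = b (i + 1) * d (i + 2) + 1 := e2
          zify at e1 e2' ⊢
          linear_combination e1 - e2'⟩
      obtain ⟨k, hk⟩ := (hcop (i + 1) (by omega)).dvd_of_dvd_mul_left hdvd
      exact ⟨k, by rw [hk, mul_comm]⟩
    · have := (nextDen_spec m2).2.2.1
      rw [← e3] at this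
      exact this
  have hi2 : (i : ℕ) + 2 ≤ h + 1 := by omega
  obtain ⟨hL0, hL1⟩ := fareyL_of_denominators hQ hpos hstep i (by omega)
  obtain ⟨-, hL2⟩ := fareyL_of_denominators hQ hpos hstep (i + 1) (by omega)
  obtain ⟨⟨k, hk⟩, hle, hlt⟩ := hstep i hi2
  have hK := fareyK_of_denominators hQ (hpos _ (by omega)) hk hle hlt hL0 hL1
  rw [hpt, hK, hL0, hL2]
  have g0 := hval i (by omega) (by omega)
  have g2 := hval (i + 2) (by omega) (by omega)
  have e0 : γ ⟨(j : ℕ) + i + 2, by omega⟩ = (b (i + 2) : ℝ) / d (i + 2) := g2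
  rw [e0, g0]
  have p0 : (0 : ℝ) < d i := by exact_mod_cast hpos i (by omega)
  have p1 : (0 : ℝ) < d (i + 1) := by exact_mod_cast hpos (i + 1) (by omega)
  have p2 : (0 : ℝ) < d (i + 2) := by exact_mod_cast hpos (i + 2) (by omega)
  have pQ : (0 : ℝ) < Q := by exact_mod_cast hQ
  have e1 : (b (i + 1) : ℝ) * d i = b i * d (i + 1) + 1 := by
    exact_mod_cast (hnext i (by omega)).2.2
  have e2 : (b (i + 2) : ℝ) * d (i + 1) = b (i + 1) * d (i + 2) + 1 := by
    exact_mod_cast (hnext (i + 1) (by omega)).2.2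
  have hk' : (d i : ℝ) + d (i + 2) = k * d (i + 1) := by exact_mod_cast hk
  -- This is the numerator of the gap; multiplied by d₁, the determinant identities reduce it to d₀
  -- + d₂ = k d₁.
  have hkey : (b (i + 2) : ℝ) * d i - b i * d (i + 2) = k := by
    have : ((b (i + 2) : ℝ) * d i - b i * d (i + 2)) * d (i + 1) = k * d (i + 1) := by
      rw [← hk']
      linear_combination (d i : ℝ) * e2 + (d (i + 2) : ℝ) * e1
    exact mul_right_cancel₀ p1.ne' this
  push_cast
  rw [div_sub_div _ _ p2.ne' p0.ne', ← hkey]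
  simp only [add_assoc]
  norm_num
  field_simp

end FareyNeighbours

/-! ### The map `fareyPhi`: invariance, continuity, scaling and support. -/

section FareyMap

/-- The floor is chosen so that the next value falls in (1 - Lₙ₊₁, 1]. -/
theorem fareyL_mem_fareyTriangle {p : ℝ × ℝ} (hp : p ∈ fareyTriangle) (n : ℕ) :
    (fareyL n p, fareyL (n + 1) p) ∈ fareyTriangle := by
  induction n with
  | zero => simpa [fareyL] using hp
  | succ n ih =>
    obtain ⟨h1, h2, h3, h4, h5⟩ := ih
    simp only at h1 h2 h3 h4 h5
    have hf := Int.floor_eq_iff.1 (rfl : fareyK n p = fareyK n p)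
    rw [le_div_iff₀ h3, div_lt_iff₀ h3] at hf
    have hL := fareyL_add_two n p
    refine ⟨h3, h4, ?_, ?_, ?_⟩ <;> simp only <;> rw [hL] <;> linarith [hf.1, hf.2]

theorem exists_int_combination_fareyL (n : ℕ) (p : ℝ × ℝ) :
    (∃ a b : ℤ, fareyL n p = a * p.1 + b * p.2) ∧
      ∃ a b : ℤ, fareyL (n + 1) p = a * p.1 + b * p.2 := by
  induction n with
  | zero => exact ⟨⟨1, 0, by simp [fareyL]⟩, ⟨0, 1, by simp [fareyL]⟩⟩
  | succ n ih =>
    obtain ⟨⟨a, b, h1⟩, ⟨c, d, h2⟩⟩ := ih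
    refine ⟨⟨c, d, h2⟩, ⟨fareyK n p * c - a, fareyK n p * d - b, ?_⟩⟩
    rw [fareyL_add_two, h1, h2]
    push_cast
    ring

theorem volume_line_eq_zero (a b : ℝ) : volume {p : ℝ × ℝ | a * p.1 + b * p.2 = 1} = 0 := by
  have hm : MeasurableSet {p : ℝ × ℝ | a * p.1 + b * p.2 = 1} :=
    measurableSet_eq_fun (by fun_prop) (by fun_prop)
  rw [Measure.volume_eq_prod]
  by_cases hb : b = 0
  · by_cases ha : a = 0
    · have : {p : ℝ × ℝ | a * p.1 + b * p.2 = 1} = ∅ := by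
        ext p; simp [ha, hb]
      rw [this, measure_empty]
    · rw [Measure.prod_apply_symm hm]
      refine (lintegral_congr fun y => ?_).trans lintegral_zero
      refine measure_mono_null (t := {1 / a}) (fun x hx => ?_) (by simp)
      simp only [Set.mem_preimage, Set.mem_ofPred_eq, hb, zero_mul, add_zero] at hx
      rw [Set.mem_singleton_iff, eq_div_iff ha, mul_comm]
      exact hx
  · rw [Measure.prod_apply hm]
    refine (lintegral_congr fun x => ?_).trans lintegral_zero
    refine measure_mono_null (t := {(1 - a * x) / b}) (fun y hy => ?_) (by simp)
    simp only [Set.mem_preimage, Set.mem_ofPred_eq] at hy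
    rw [Set.mem_singleton_iff, eq_div_iff hb]
    linarith

/-- At each point Lₙ is an integer combination of the coordinates, so the exceptional set lies in a
countable union of lines ax + by = 1. -/
theorem ae_fareyL_ne_one : ∀ᵐ p : ℝ × ℝ, ∀ n, fareyL n p ≠ 1 := by
  have h : ∀ᵐ p : ℝ × ℝ, ∀ a b : ℤ, ¬((a : ℝ) * p.1 + b * p.2 = 1) := by
    rw [ae_all_iff]; intro a
    rw [ae_all_iff]; intro b
    rw [ae_iff]
    simpa only [not_not] using volume_line_eq_zero a b
  filter_upwards [h] with p hp n hn
  obtain ⟨a, b, hab⟩ := (exists_int_combination_fareyL n p).1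
  exact hp a b (hab ▸ hn)

theorem measurable_fareyL (n : ℕ) : Measurable (fareyL n) ∧ Measurable (fareyL (n + 1)) := by
  induction n with
  | zero =>
    exact ⟨measurable_fst, measurable_snd⟩
  | succ n ih =>
    refine ⟨ih.2, ?_⟩
    have h : Measurable fun p => (⌊(1 + fareyL n p) / fareyL (n + 1) p⌋ : ℝ) *
        fareyL (n + 1) p - fareyL n p :=
      ((measurable_from_top.comp ((measurable_const.add ih.1).div ih.2).floor).mul ih.2).sub ih.1
    exact h

theorem measurable_fareyK (n : ℕ) : Measurable fun p => (fareyK n p : ℝ) :=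
  measurable_from_top.comp
    ((measurable_const.add (measurable_fareyL n).1).div (measurable_fareyL n).2).floor

theorem measurable_fareyPhi (h : ℕ) : Measurable (fareyPhi h) :=
  measurable_pi_lambda _ fun i => ((measurable_fareyK i).div
    ((measurable_fareyL i).1.mul (measurable_fareyL (i + 2)).1)).const_mul _

/-- The floor can jump only where its argument is an integer, that is, where k Lₙ₊₁ - Lₙ = 1. -/
theorem continuousAt_fareyK_of {p : ℝ × ℝ} (hp : p ∈ fareyTriangle) {n : ℕ}
    (hne : fareyL (n + 2) p ≠ 1) (h0 : ContinuousAt (fareyL n) p)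
    (h1 : ContinuousAt (fareyL (n + 1)) p) : ContinuousAt (fun p => (fareyK n p : ℝ)) p := by
  obtain ⟨-, -, hpos, -, -⟩ := fareyL_mem_fareyTriangle hp n
  simp only at hpos
  have hq : ContinuousAt (fun p => (1 + fareyL n p) / fareyL (n + 1) p) p :=
    (continuousAt_const.add h0).div h1 hpos.ne'
  have hK : ∀ᶠ p' in 𝓝 p, fareyK n p' = fareyK n p := by
    have hf := Int.floor_eq_iff.1 (rfl : fareyK n p = fareyK n p)
    have hlt : (fareyK n p : ℝ) < (1 + fareyL n p) / fareyL (n + 1) p := by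
      refine lt_of_le_of_ne hf.1 fun h => hne ?_
      rw [eq_div_iff hpos.ne'] at h
      rw [fareyL_add_two]
      linarith
    filter_upwards [hq.eventually (lt_mem_nhds hlt), hq.eventually (gt_mem_nhds hf.2)] with p' h1 h2
    exact Int.floor_eq_iff.2 ⟨h1.le, h2⟩
  refine (continuousAt_const (y := (fareyK n p : ℝ))).congr ?_
  filter_upwards [hK] with p' hp'
  rw [hp']

theorem continuousAt_fareyL {p : ℝ × ℝ} (hp : p ∈ fareyTriangle) {n : ℕ}
    (hne : ∀ i ≤ n + 1, fareyL i p ≠ 1) : ContinuousAt (fareyL n) p ∧ ContinuousAt (fareyL (n + 1)) p := by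
  induction n with
  | zero => exact ⟨continuousAt_fst, continuousAt_snd⟩
  | succ n ih =>
    obtain ⟨h0, h1⟩ := ih fun i hi => hne i (by omega)
    refine ⟨h1, ?_⟩
    have h := ((continuousAt_fareyK_of hp (hne (n + 2) le_rfl) h0 h1).mul h1).sub h0
    exact h.congr (Eventually.of_forall fun p' => (fareyL_add_two n p').symm)

theorem continuousAt_fareyPhi {p : ℝ × ℝ} (hp : p ∈ fareyTriangle) {h : ℕ}
    (hne : ∀ i ≤ h + 1, fareyL i p ≠ 1) : ContinuousAt (fareyPhi h) p := by
  refine continuousAt_pi.2 fun i => ?_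
  have c : ∀ n ≤ h, ContinuousAt (fareyL n) p ∧ ContinuousAt (fareyL (n + 1)) p := fun n hn =>
    continuousAt_fareyL hp fun i hi => hne i (by omega)
  have c0 := (c i (by omega)).1
  obtain ⟨c1, c2⟩ := c (i + 1) (by omega)
  have hpos : ∀ n, fareyL n p ≠ 0 := fun n => (fareyL_mem_fareyTriangle hp n).1.ne'
  exact continuousAt_const.mul ((continuousAt_fareyK_of hp (hne _ (by omega)) c0 c1).div
    (c0.mul c2) (mul_ne_zero (hpos _) (hpos _)))

/-- Shrinking increases (1 + Lₙ)/Lₙ₊₁, so the lower floor inequality persists; the upper one becomes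
the hypothesis `ht`. -/
theorem fareyK_smul {p : ℝ × ℝ} (hp : p ∈ fareyTriangle) {t : ℝ} (ht0 : 0 < t) (ht1 : t ≤ 1)
    {n : ℕ} (ht : 1 < t * (fareyL (n + 1) p + fareyL (n + 2) p))
    (h0 : fareyL n (t • p) = t * fareyL n p)
    (h1 : fareyL (n + 1) (t • p) = t * fareyL (n + 1) p) : fareyK n (t • p) = fareyK n p := by
  obtain ⟨-, -, hpos, -, -⟩ := fareyL_mem_fareyTriangle hp n
  simp only at hpos
  have hf := Int.floor_eq_iff.1 (rfl : fareyK n p = fareyK n p)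
  rw [le_div_iff₀ hpos] at hf
  rw [fareyL_add_two] at ht
  rw [fareyK, h0, h1, Int.floor_eq_iff, le_div_iff₀ (by positivity), div_lt_iff₀ (by positivity)]
  constructor
  · nlinarith [hf.1]
  · nlinarith

theorem fareyL_smul {p : ℝ × ℝ} (hp : p ∈ fareyTriangle) {t : ℝ} (ht0 : 0 < t) (ht1 : t ≤ 1)
    {m : ℕ} (ht : ∀ n ≤ m, 1 < t * (fareyL n p + fareyL (n + 1) p)) (n : ℕ) (hn : n ≤ m) :
    fareyL n (t • p) = t * fareyL n p ∧ fareyL (n + 1) (t • p) = t * fareyL (n + 1) p := by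
  induction n with
  | zero => simp [fareyL]
  | succ n ih =>
    obtain ⟨h0, h1⟩ := ih (by omega)
    refine ⟨h1, ?_⟩
    rw [fareyL_add_two, fareyK_smul hp ht0 ht1 (ht (n + 1) hn) h0 h1, h0, h1, fareyL_add_two]
    ring

theorem fareyPhi_smul {p : ℝ × ℝ} (hp : p ∈ fareyTriangle) {t : ℝ} (ht0 : 0 < t) (ht1 : t ≤ 1)
    {h : ℕ} (ht : ∀ n ≤ h, 1 < t * (fareyL n p + fareyL (n + 1) p)) :
    fareyPhi h (t • p) = (t ^ 2)⁻¹ • fareyPhi h p := by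
  ext i
  obtain ⟨h0, h1⟩ := fareyL_smul hp ht0 ht1 ht i (by omega)
  obtain ⟨-, h2⟩ := fareyL_smul hp ht0 ht1 ht (i + 1) (by omega)
  have hK := fareyK_smul hp ht0 ht1 (ht (i + 1) (by omega)) h0 h1
  simp only [fareyPhi, Pi.smul_apply, smul_eq_mul]
  rw [hK, h0, h2]
  field_simp

theorem fareyTriangle_mem_nhds {p : ℝ × ℝ} (h1 : 0 < p.1) (h2 : p.1 < 1) (h3 : 0 < p.2)
    (h4 : p.2 < 1) (h5 : 1 < p.1 + p.2) : fareyTriangle ∈ 𝓝 p := by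
  have e1 := continuousAt_fst.eventually (lt_mem_nhds h1)
  have e2 := continuousAt_fst.eventually (gt_mem_nhds h2)
  have e3 := continuousAt_snd.eventually (lt_mem_nhds h3)
  have e4 := continuousAt_snd.eventually (gt_mem_nhds h4)
  have e5 := (continuousAt_fst.add continuousAt_snd).eventually (lt_mem_nhds h5)
  filter_upwards [e1, e2, e3, e4, e5] with p' h1 h2 h3 h4 h5
  exact ⟨h1, h2.le, h3, h4.le, h5⟩

/-- Continuity may fail at p itself, on the boundary or where some Lᵢ = 1. For t < 1 close to 1 the
point t p is interior, all relevant Lᵢ(t p) = t Lᵢ(p) are below 1, and the value t⁻² `fareyPhi h p`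
still lies in the interior of G; a neighbourhood of t p then has positive area. -/
theorem volume_fareyTriangle_inter_preimage_pos {p : ℝ × ℝ} (hp : p ∈ fareyTriangle) {h : ℕ}
    {G : Set (Fin h → ℝ)} (hG : G ∈ 𝓝 (fareyPhi h p)) :
    0 < volume (fareyTriangle ∩ fareyPhi h ⁻¹' G) := by
  have hpos : ∀ n, 0 < fareyL n p := fun n => (fareyL_mem_fareyTriangle hp n).1
  have hle : ∀ n, fareyL n p ≤ 1 := fun n => (fareyL_mem_fareyTriangle hp n).2.1
  have hsum : ∀ n, 1 < fareyL n p + fareyL (n + 1) p :=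
    fun n => (fareyL_mem_fareyTriangle hp n).2.2.2.2
  have hev1 : ∀ᶠ t : ℝ in 𝓝[<] 1, ∀ n ∈ Finset.range (h + 1),
      1 < t * (fareyL n p + fareyL (n + 1) p) := by
    rw [Filter.eventually_all_finset]
    intro n _
    refine nhdsWithin_le_nhds ?_
    have : Tendsto (fun t : ℝ => t * (fareyL n p + fareyL (n + 1) p)) (𝓝 1)
        (𝓝 (1 * (fareyL n p + fareyL (n + 1) p))) := tendsto_id.mul_const _
    rw [one_mul] at this
    exact this.eventually (lt_mem_nhds (hsum n))
  have hev2 : ∀ᶠ t : ℝ in 𝓝[<] 1, interior G ∈ 𝓝 ((t ^ 2)⁻¹ • fareyPhi h p) := by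
    refine nhdsWithin_le_nhds ?_
    have : Tendsto (fun t : ℝ => (t ^ 2)⁻¹ • fareyPhi h p) (𝓝 1)
        (𝓝 (((1 : ℝ) ^ 2)⁻¹ • fareyPhi h p)) :=
      ((tendsto_id.pow 2).inv₀ (by norm_num)).smul_const _
    rw [one_pow, inv_one, one_smul] at this
    filter_upwards [this (interior_mem_nhds.2 hG)] with t ht
    exact isOpen_interior.mem_nhds ht
  have hev3 : ∀ᶠ t : ℝ in 𝓝[<] 1, t ∈ Set.Ioo (0 : ℝ) 1 := Ioo_mem_nhdsLT one_pos
  obtain ⟨t, h1, h2, h3, h4⟩ := (hev1.and (hev2.and hev3)).exists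
  have ht : ∀ n ≤ h, 1 < t * (fareyL n p + fareyL (n + 1) p) := fun n hn =>
    h1 n (Finset.mem_range.2 (by omega))
  have hL := fareyL_smul hp h3 h4.le ht
  have hlt : ∀ n, t * fareyL n p < 1 := fun n => by nlinarith [hpos n, hle n]
  have hne : ∀ i ≤ h + 1, fareyL i (t • p) ≠ 1 := by
    intro i hi
    rcases Nat.lt_or_ge i (h + 1) with hi' | hi'
    · rw [(hL i (by omega)).1]; exact (hlt i).ne
    · obtain rfl : i = h + 1 := by omega
      rw [(hL h le_rfl).2]; exact (hlt _).ne
  have hT : fareyTriangle ∈ 𝓝 (t • p) := by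
    have e0 := hlt 0
    have e1 := hlt 1
    have e2 := ht 0 (Nat.zero_le _)
    simp only [fareyL] at e0 e1 e2
    obtain ⟨a, -, b, -, -⟩ := hp
    exact fareyTriangle_mem_nhds (mul_pos h3 a) e0 (mul_pos h3 b) e1
      (by simpa [mul_add] using e2)
  have hc := continuousAt_fareyPhi (mem_of_mem_nhds hT) hne
  have hG' : fareyPhi h ⁻¹' G ∈ 𝓝 (t • p) := by
    refine hc ?_
    rw [fareyPhi_smul hp h3 h4.le ht]
    exact mem_of_superset h2 interior_subset
  exact Measure.measure_pos_of_mem_nhds volume (inter_mem hT hG')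

/-- The limit of the third level measures of Farey fractions. -/
noncomputable def thirdLimit (h : ℕ) : Measure (Fin h → ℝ) :=
  ((2 : ℝ≥0∞) • volume.restrict fareyTriangle).map (fareyPhi h)

instance isProbabilityMeasure_thirdLimit (h : ℕ) : IsProbabilityMeasure (thirdLimit h) :=
  Measure.isProbabilityMeasure_map (measurable_fareyPhi h).aemeasurable

theorem thirdLimit_apply (h : ℕ) {A : Set (Fin h → ℝ)} (hA : MeasurableSet A) :
    thirdLimit h A = 2 * volume (fareyTriangle ∩ fareyPhi h ⁻¹' A) := by
  rw [thirdLimit, Measure.map_apply (measurable_fareyPhi h) hA, Measure.smul_apply,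
    Measure.restrict_apply (measurable_fareyPhi h hA), smul_eq_mul, Set.inter_comm]

theorem support_thirdLimit (h : ℕ) :
    (thirdLimit h).support = closure (fareyPhi h '' fareyTriangle) := by
  refine Set.Subset.antisymm ?_ ?_
  · refine Measure.support_subset_of_isClosed isClosed_closure ?_
    rw [mem_ae_iff, thirdLimit_apply h isClosed_closure.measurableSet.compl]
    have : fareyTriangle ∩ fareyPhi h ⁻¹' (closure (fareyPhi h '' fareyTriangle))ᶜ = ∅ := by
      ext p
      simp only [Set.mem_inter_iff, Set.mem_preimage, Set.mem_compl_iff, Set.mem_empty_iff_false,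
        iff_false, not_and, not_not]
      exact fun hp => subset_closure ⟨p, hp, rfl⟩
    rw [this]
    simp
  · refine closure_minimal ?_ Measure.isClosed_support
    rintro _ ⟨p, hp, rfl⟩
    rw [Measure.mem_support_iff_forall]
    intro U hU
    refine lt_of_lt_of_le ?_ (measure_mono interior_subset)
    rw [thirdLimit_apply h isOpen_interior.measurableSet]
    exact ENNReal.mul_pos (by simp)
      (volume_fareyTriangle_inter_preimage_pos hp (interior_mem_nhds.2 hU)).ne'

end FareyMap

/-- `thirdLimit` as a bundled probability measure. -/
noncomputable def thirdLimitLaw (h : ℕ) : ProbabilityMeasure (Fin h → ℝ) :=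
  ⟨thirdLimit h, inferInstance⟩

/-! ### Convergence of the gap measures. -/

section ThirdMeasure

theorem thirdMeasure_eq_meanDirac (h : ℕ) {N : ℕ} (x : Fin N → ℝ) :
    thirdMeasure h x = meanDirac (Finset.univ : Finset (Fin (N - h - 1))) fun j =>
      fun i : Fin h => x ⟨(j : ℕ) + (i : ℕ) + 2, by omega⟩ - x ⟨(j : ℕ) + (i : ℕ), by omega⟩ := by
  rw [thirdMeasure, meanDirac, Finset.card_univ, Fintype.card_fin]
  rcases Nat.eq_zero_or_pos (N - h - 1) with h0 | h0
  · have : IsEmpty (Fin (N - h - 1)) := by rw [h0]; infer_instance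
    simp
  · have h1 : ((N - h - 1 : ℕ) : ℝ≥0) ≠ 0 := by exact_mod_cast h0.ne'
    ext A hA
    rw [Measure.smul_apply, Measure.smul_apply, ENNReal.smul_def, ENNReal.coe_inv h1]
    simp

theorem isProbabilityMeasure_thirdMeasure {h N : ℕ} (hN : h + 1 < N) (x : Fin N → ℝ) :
    IsProbabilityMeasure (thirdMeasure h x) := by
  rw [thirdMeasure_eq_meanDirac]
  have : Nonempty (Fin (N - h - 1)) := ⟨⟨0, by omega⟩⟩
  exact isProbabilityMeasure_meanDirac Finset.univ_nonempty _

/-- The number `N(Q, I) / |I|`, divided by its asymptotic value `3 Q² / π²`. -/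
noncomputable def fareyScale (Q : ℕ) (I : Set ℝ) : ℝ :=
  (fareyCount Q I : ℝ) / volume.real I / (Q : ℝ) ^ 2 / (3 / Real.pi ^ 2)

theorem fareyNormalized_gap {Q h : ℕ} {I : Set ℝ} (hI : I.OrdConnected)
    {j : Fin (fareyCount Q I)} (hjN : (j : ℕ) < fareyCount Q I - h - 1) {p : Σ _ : ℕ, ℕ}
    (hp : p ∈ fareyPairs Q) (hj : fareyEnum Q I j = (p.2 : ℝ) / p.1) :
    (fun i : Fin h => fareyNormalized Q I ⟨(j : ℕ) + i + 2, by omega⟩ -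
      fareyNormalized Q I ⟨(j : ℕ) + i, by omega⟩) =
      fareyScale Q I • fareyPhi h (fareyPoint Q p).2 := by
  obtain ⟨⟨h1, h2⟩, -, h3⟩ := mem_fareyPairs.1 hp
  ext i
  have hgap := fareyEnum_gap hI hjN h1 h2 h3 hj i
  have e : ∀ k, fareyNormalized Q I k = (fareyCount Q I : ℝ) * fareyEnum Q I k / volume.real I :=
    fun k => rfl
  rw [e, e, ← sub_div, ← mul_sub, hgap]
  simp only [fareyScale, fareyPhi, Pi.smul_apply, smul_eq_mul]
  have hπ : (3 / Real.pi ^ 2 : ℝ) ≠ 0 := by positivity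
  field_simp

open Classical in
-- A fraction in I is matched with its index; at most h + 1 indices lie too near the end to start a
-- full gap vector. One inequality is enough, as only lower bounds on open sets are sought.
theorem card_filter_fareyPairs_le {Q h : ℕ} {I : Set ℝ} (hI : I.OrdConnected)
    (G : Set (Fin h → ℝ)) :
    ((fareyPairs Q).filter fun p => (p.2 : ℝ) / p.1 ∈ I ∧
      fareyScale Q I • fareyPhi h (fareyPoint Q p).2 ∈ G).card ≤
    ((Finset.univ : Finset (Fin (fareyCount Q I - h - 1))).filter
      fun j : Fin (fareyCount Q I - h - 1) =>
      (fun i : Fin h => fareyNormalized Q I ⟨(j : ℕ) + i + 2, by omega⟩ -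
        fareyNormalized Q I ⟨(j : ℕ) + i, by omega⟩) ∈ G).card + (h + 1) := by
  set N := fareyCount Q I with hN
  set A := (fareyPairs Q).filter fun p => (p.2 : ℝ) / p.1 ∈ I ∧
      fareyScale Q I • fareyPhi h (fareyPoint Q p).2 ∈ G with hA
  set B := (Finset.univ : Finset (Fin (N - h - 1))).filter fun j : Fin (N - h - 1) =>
      (fun i : Fin h => fareyNormalized Q I ⟨(j : ℕ) + i + 2, by omega⟩ -
        fareyNormalized Q I ⟨(j : ℕ) + i, by omega⟩) ∈ G with hB
  have hex : ∀ p : Σ _ : ℕ, ℕ, ∃ j : ℕ, p ∈ A →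
      ∃ hj : j < N, fareyEnum Q I ⟨j, hj⟩ = (p.2 : ℝ) / p.1 := by
    intro p
    by_cases hp : p ∈ A
    · obtain ⟨hp1, hp2, -⟩ := Finset.mem_filter.1 hp
      obtain ⟨⟨h1, h2⟩, h3, h4⟩ := mem_fareyPairs.1 hp1
      obtain ⟨j, hj⟩ := exists_fareyEnum_eq
        (mem_fareyIn.2 ⟨mem_farey.2 ⟨p.2, p.1, h1, h2, h3.le, h4, rfl⟩, hp2⟩)
      exact ⟨j, fun _ => ⟨j.2, hj⟩⟩
    · exact ⟨0, fun h => absurd h hp⟩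
  choose f hf using hex
  have hinj : Set.InjOn f A := by
    intro p hp p' hp' hpp
    obtain ⟨hj, e⟩ := hf p hp
    obtain ⟨hj', e'⟩ := hf p' hp'
    have h0 : (p.2 : ℝ) / p.1 = (p'.2 : ℝ) / p'.1 := by
      rw [← e, ← e']
      congr 2
    obtain ⟨⟨h1, -⟩, -, h4⟩ := mem_fareyPairs.1 (Finset.mem_filter.1 hp).1
    obtain ⟨⟨h1', -⟩, -, h4'⟩ := mem_fareyPairs.1 (Finset.mem_filter.1 hp').1
    obtain ⟨ha, hq⟩ := coprime_div_injective h1 h1' h4 h4' h0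
    exact Sigma.ext hq (heq_of_eq ha)
  have hsub : A.image f ⊆ B.image (fun j : Fin (N - h - 1) => (j : ℕ)) ∪ Finset.Ico (N - h - 1) N := by
    intro n hn
    obtain ⟨p, hp, rfl⟩ := Finset.mem_image.1 hn
    obtain ⟨hj, e⟩ := hf p hp
    obtain ⟨hp1, -, hp3⟩ := Finset.mem_filter.1 hp
    rw [Finset.mem_union, Finset.mem_Ico, Finset.mem_image]
    rcases Nat.lt_or_ge (f p) (N - h - 1) with hlt | hge
    · refine Or.inl ⟨⟨f p, hlt⟩, Finset.mem_filter.2 ⟨Finset.mem_univ _, ?_⟩, rfl⟩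
      have := fareyNormalized_gap (h := h) hI (j := ⟨f p, hj⟩) hlt hp1 e
      rw [← this] at hp3
      exact hp3
    · exact Or.inr ⟨hge, hj⟩
  calc A.card = (A.image f).card := (Finset.card_image_of_injOn hinj).symm
    _ ≤ _ := (Finset.card_le_card hsub).trans (Finset.card_union_le _ _)
    _ ≤ B.card + (h + 1) := by
      refine Nat.add_le_add Finset.card_image_le ?_
      rw [Nat.card_Ico]
      omega

open Classical in
-- The discrepancy is the fraction 1, which is a Farey fraction but comes from no pair with a < q.
theorem card_filter_le_fareyCount (Q : ℕ) (I : Set ℝ) :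
    ((fareyPairs Q).filter fun p => (p.2 : ℝ) / p.1 ∈ I).card ≤ fareyCount Q I ∧
      fareyCount Q I ≤ ((fareyPairs Q).filter fun p => (p.2 : ℝ) / p.1 ∈ I).card + 1 := by
  set B := (fareyPairs Q).filter fun p => (p.2 : ℝ) / p.1 ∈ I with hB
  constructor
  · refine Finset.card_le_card_of_injOn (fun p => (p.2 : ℝ) / p.1) ?_ ?_
    · intro p hp
      obtain ⟨hp1, hp2⟩ := Finset.mem_filter.1 hp
      obtain ⟨⟨h1, h2⟩, h3, h4⟩ := mem_fareyPairs.1 hp1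
      exact mem_fareyIn.2 ⟨mem_farey.2 ⟨p.2, p.1, h1, h2, h3.le, h4, rfl⟩, hp2⟩
    · intro p hp p' hp' hpp
      obtain ⟨⟨h1, -⟩, -, h4⟩ := mem_fareyPairs.1 (Finset.mem_filter.1 hp).1
      obtain ⟨⟨h1', -⟩, -, h4'⟩ := mem_fareyPairs.1 (Finset.mem_filter.1 hp').1
      obtain ⟨ha, hq⟩ := coprime_div_injective h1 h1' h4 h4' hpp
      exact Sigma.ext hq (heq_of_eq ha)
  · have hsub : fareyIn Q I ⊆ insert 1 (B.image fun p => (p.2 : ℝ) / p.1) := by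
      intro x hx
      obtain ⟨hx1, hx2⟩ := mem_fareyIn.1 hx
      obtain ⟨a, q, h1, h2, h3, h4, rfl⟩ := mem_farey.1 hx1
      rw [Finset.mem_insert, Finset.mem_image]
      rcases h3.lt_or_eq with h5 | h5
      · exact Or.inr ⟨⟨q, a⟩, Finset.mem_filter.2 ⟨mem_fareyPairs.2 ⟨⟨h1, h2⟩, h5, h4⟩, hx2⟩, rfl⟩
      · left
        rw [h5, div_self]
        exact_mod_cast h1.ne'
    refine (Finset.card_le_card hsub).trans ((Finset.card_insert_le _ _).trans ?_)
    exact Nat.add_le_add_right Finset.card_image_le 1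

theorem volume_interior_of_ordConnected {I : Set ℝ} (hI : I.OrdConnected) :
    volume (interior I) = volume I := by
  refine le_antisymm (measure_mono interior_subset) ?_
  have h1 : volume (frontier I) = 0 := hI.convex.addHaar_frontier volume
  calc volume I ≤ volume (interior I ∪ frontier I) := by
        refine measure_mono ?_
        rw [← closure_eq_interior_union_frontier]
        exact subset_closure
    _ ≤ volume (interior I) + volume (frontier I) := measure_union_le _ _
    _ = volume (interior I) := by rw [h1, add_zero]

theorem restrict_Ico_apply_of_subset_Icc {S : Set ℝ} (hS : S ⊆ Set.Icc 0 1) :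
    volume.restrict (Set.Ico (0 : ℝ) 1) S = volume S := by
  rw [restrict_Ico_eq_restrict_Icc, Measure.restrict_eq_self _ hS]

theorem volume_pos_of_ordConnected {I : Set ℝ} (hI : I.OrdConnected) (hn : I.Nontrivial) :
    0 < volume I := by
  obtain ⟨a, ha, b, hb, hab⟩ := hn.exists_lt
  refine lt_of_lt_of_le ?_ (measure_mono (hI.out ha hb))
  simpa using hab

theorem le_totientSum (Q : ℕ) : Q ≤ totientSum Q := by
  calc Q = ∑ q ∈ Finset.Ioc 0 Q, 1 := by simp
    _ ≤ totientSum Q :=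
      Finset.sum_le_sum fun q hq => Nat.totient_pos.2 (Finset.mem_Ioc.1 hq).1

theorem tendsto_totientSum_atTop : Tendsto (fun Q => (totientSum Q : ℝ)) atTop atTop :=
  tendsto_atTop_mono (fun Q => by exact_mod_cast le_totientSum Q) tendsto_natCast_atTop_atTop

/-- This is equidistribution of the first coordinate, tested on I × univ, whose frontier is null. -/
theorem tendsto_fareyCount_div_totientSum {I : Set ℝ} (hI01 : I ⊆ Set.Icc 0 1)
    (hI : I.OrdConnected) :
    Tendsto (fun k : ℕ => (fareyCount (k + 1) I : ℝ) / totientSum (k + 1)) atTop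
      (𝓝 (volume.real I)) := by
  classical
  have hmI : MeasurableSet I := hI.measurableSet
  have hm : MeasurableSet (I ×ˢ (Set.univ : Set (ℝ × ℝ))) := hmI.prod MeasurableSet.univ
  have hfr : fareyLimitLaw
      (frontier (I ×ˢ (Set.univ : Set (ℝ × ℝ)))) = 0 := by
    rw [ProbabilityMeasure.null_iff_toMeasure_null, fareyLimitLaw, ProbabilityMeasure.coe_mk,
      frontier_prod_univ_eq, fareyLimit, Measure.prod_prod, measure_univ, mul_one]
    exact Measure.absolutelyContinuous_restrict (hI.convex.addHaar_frontier volume)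
  have h1 := ProbabilityMeasure.tendsto_measure_of_null_frontier_of_tendsto tendsto_fareyLaw hfr
  have h2 : (fareyLimitLaw
      (I ×ˢ (Set.univ : Set (ℝ × ℝ))) : ℝ) = volume.real I := by
    change (fareyLimit (I ×ˢ (Set.univ : Set (ℝ × ℝ)))).toReal = _
    rw [fareyLimit, Measure.prod_prod, measure_univ, mul_one,
      restrict_Ico_apply_of_subset_Icc hI01]
    rfl
  have h3 : ∀ k, ((fareyLaw k (I ×ˢ (Set.univ : Set (ℝ × ℝ))) : ℝ≥0) : ℝ) =
      (((fareyPairs (k + 1)).filter fun p => (p.2 : ℝ) / p.1 ∈ I).card : ℝ) /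
        totientSum (k + 1) := by
    intro k
    change (meanDirac (fareyPairs (k + 1)) (fareyPoint (k + 1))
      (I ×ˢ (Set.univ : Set (ℝ × ℝ)))).toReal = _
    rw [meanDirac_apply _ _ hm, ENNReal.toReal_div, card_fareyPairs]
    simp [fareyPoint]
  rw [← NNReal.tendsto_coe, h2] at h1
  simp_rw [h3] at h1
  have h4 : Tendsto (fun k : ℕ => (1 : ℝ) / totientSum (k + 1)) atTop (𝓝 0) :=
    (tendsto_const_nhds.div_atTop tendsto_totientSum_atTop).comp (tendsto_add_atTop_nat 1)
  have h5 := h1.add h4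
  rw [add_zero] at h5
  refine tendsto_of_tendsto_of_tendsto_of_le_of_le h1 h5 (fun k => ?_) (fun k => ?_)
  · have := (card_filter_le_fareyCount (k + 1) I).1
    simp only
    gcongr
  · have := (card_filter_le_fareyCount (k + 1) I).2
    simp only
    rw [← add_div]
    gcongr
    exact_mod_cast this

theorem tendsto_fareyScale {I : Set ℝ} (hI01 : I ⊆ Set.Icc 0 1) (hI : I.OrdConnected)
    (hpos : 0 < volume.real I) : Tendsto (fun k => fareyScale (k + 1) I) atTop (𝓝 1) := by
  have hc : (3 / Real.pi ^ 2 : ℝ) ≠ 0 := by positivity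
  have h1 := tendsto_fareyCount_div_totientSum hI01 hI
  have h2 := tendsto_totientSum_div_sq.comp (tendsto_add_atTop_nat 1)
  have h3 := ((h1.mul h2).div_const (volume.real I)).div_const (3 / Real.pi ^ 2)
  rw [mul_div_cancel_left₀ _ hpos.ne', div_self hc] at h3
  refine h3.congr fun k => ?_
  have h4 : (totientSum (k + 1) : ℝ) ≠ 0 := by exact_mod_cast (totientSum_pos k.succ_pos).ne'
  simp only [Function.comp, fareyScale]
  field_simp

open Classical in
-- The extended mapping theorem absorbs the varying scale. The product form of `fareyLimit` splits
-- off the factor |I|, which is where independence of I comes from.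
theorem volume_mul_thirdLimit_le_liminf {h : ℕ} {I : Set ℝ} (hI01 : I ⊆ Set.Icc 0 1)
    (hI : I.OrdConnected) (hpos : 0 < volume.real I) {G : Set (Fin h → ℝ)} (hG : IsOpen G) :
    volume I * thirdLimit h G ≤ liminf (fun k : ℕ => (((fareyPairs (k + 1)).filter fun p =>
      (p.2 : ℝ) / p.1 ∈ I ∧ fareyScale (k + 1) I • fareyPhi h (fareyPoint (k + 1) p).2 ∈ G).card :
        ℝ≥0∞) / totientSum (k + 1)) atTop := by
  have hcont : ∀ᵐ w ∂fareyLimit, ContinuousAt (fareyPhi h) w.2 := by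
    have h1 : ∀ᵐ p ∂((2 : ℝ≥0∞) • volume.restrict fareyTriangle), ContinuousAt (fareyPhi h) p := by
      refine Measure.ae_smul_measure ?_ _
      filter_upwards [ae_restrict_mem measurableSet_fareyTriangle,
        ae_restrict_of_ae ae_fareyL_ne_one] with p hp hne
      exact continuousAt_fareyPhi hp fun i _ => hne i
    exact Measure.quasiMeasurePreserving_snd.ae h1
  have key := le_liminf_measure_preimage_of_tendsto tendsto_fareyLaw
    (φ := fun k (w : ℝ × ℝ × ℝ) => (w.1, fareyScale (k + 1) I • fareyPhi h w.2))
    (ψ := fun w => (w.1, fareyPhi h w.2)) (by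
      filter_upwards [hcont] with w hw
      refine Tendsto.prodMk_nhds (continuousAt_fst.tendsto.comp tendsto_snd) ?_
      have h1 := ((tendsto_fareyScale hI01 hI hpos).comp tendsto_fst).smul
        ((hw.tendsto.comp continuousAt_snd.tendsto).comp tendsto_snd)
      rw [one_smul] at h1
      exact h1) (isOpen_interior (s := I) |>.prod hG)
  have hL : (fareyLimit : Measure (ℝ × ℝ × ℝ)) ((fun w : ℝ × ℝ × ℝ => (w.1, fareyPhi h w.2)) ⁻¹'
      interior I ×ˢ G) = volume I * thirdLimit h G := by
    have : ((fun w : ℝ × ℝ × ℝ => (w.1, fareyPhi h w.2)) ⁻¹' interior I ×ˢ G) =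
        interior I ×ˢ (fareyPhi h ⁻¹' G) := rfl
    rw [this, fareyLimit, Measure.prod_prod,
      restrict_Ico_apply_of_subset_Icc (interior_subset.trans hI01),
      volume_interior_of_ordConnected hI, thirdLimit,
      Measure.map_apply (measurable_fareyPhi h) hG.measurableSet]
  rw [fareyLimitLaw, ProbabilityMeasure.coe_mk, hL] at key
  refine key.trans (liminf_le_liminf (Eventually.of_forall fun k => ?_))
  have hm : MeasurableSet ((fun w : ℝ × ℝ × ℝ => (w.1, fareyScale (k + 1) I • fareyPhi h w.2)) ⁻¹'
      interior I ×ˢ G) := by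
    have hφ : Measurable fun w : ℝ × ℝ × ℝ => (w.1, fareyScale (k + 1) I • fareyPhi h w.2) :=
      measurable_fst.prodMk
        (((measurable_fareyPhi h).comp measurable_snd).const_smul (fareyScale (k + 1) I) :
          Measurable fun w : ℝ × ℝ × ℝ => fareyScale (k + 1) I • fareyPhi h w.2)
    exact hφ (isOpen_interior.prod hG).measurableSet
  change meanDirac (fareyPairs (k + 1)) (fareyPoint (k + 1)) _ ≤ _
  rw [meanDirac_apply _ _ hm, card_fareyPairs]
  refine ENNReal.div_le_div_right ?_ _
  refine Nat.cast_le.2 (Finset.card_le_card fun p hp => ?_)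
  simp only [Finset.mem_filter, Set.mem_preimage, Set.mem_prod] at hp ⊢
  exact ⟨hp.1, interior_subset hp.2.1, hp.2.2⟩

theorem le_liminf_thirdMeasure {h : ℕ} {I : Set ℝ} (hI01 : I ⊆ Set.Icc 0 1)
    (hI : I.OrdConnected) (hpos : 0 < volume.real I) {G : Set (Fin h → ℝ)} (hG : IsOpen G) :
    thirdLimit h G ≤
      liminf (fun k : ℕ => thirdMeasure h (fareyNormalized (k + 1) I) G) atTop := by
  classical
  have hfin : volume I ≠ ∞ := fun hh => by simp [measureReal_def, hh] at hpos
  refine le_of_forall_lt fun r hr => ?_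
  obtain ⟨s, hrs, hs⟩ := exists_between hr
  have hs_top : s ≠ ∞ := hs.ne_top
  have hr_top : r ≠ ∞ := hrs.ne_top
  have hvol0 : volume I ≠ 0 := fun hh => by simp [measureReal_def, hh] at hpos
  have h1 : volume I * s < volume I * thirdLimit h G :=
    ENNReal.mul_lt_mul_right hvol0 hfin hs
  have h2 := eventually_lt_of_lt_liminf
    (h1.trans_le (volume_mul_thirdLimit_le_liminf hI01 hI hpos hG))
  have hN := tendsto_fareyCount_div_totientSum hI01 hI
  have h4 : Tendsto (fun k : ℕ => ((h + 1 : ℕ) : ℝ) / totientSum (k + 1)) atTop (𝓝 0) :=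
    (tendsto_const_nhds.div_atTop tendsto_totientSum_atTop).comp (tendsto_add_atTop_nat 1)
  -- The gap between r' and s absorbs both the error (h + 1)/Φ(Q), with Φ(Q) = `totientSum Q`, and
  -- the convergence of N/Φ(Q) to |I|.
  obtain ⟨r', hrr', hr's⟩ := exists_between hrs
  have hr'_top : r' ≠ ∞ := hr's.ne_top
  have h5 := (hN.mul_const r'.toReal).add h4
  rw [add_zero] at h5
  have h6 : volume.real I * r'.toReal < volume.real I * s.toReal :=
    mul_lt_mul_of_pos_left ((ENNReal.toReal_lt_toReal hr'_top hs_top).2 hr's) hpos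
  have h7 : ∀ᶠ k : ℕ in atTop, r' ≤ thirdMeasure h (fareyNormalized (k + 1) I) G := by
    filter_upwards [h2, h5.eventually (gt_mem_nhds h6)] with k hk1 hk2
    by_contra! hlt
    have hΦ : (0 : ℝ) < totientSum (k + 1) := by exact_mod_cast totientSum_pos k.succ_pos
    set A := ((fareyPairs (k + 1)).filter fun p => (p.2 : ℝ) / p.1 ∈ I ∧
      fareyScale (k + 1) I • fareyPhi h (fareyPoint (k + 1) p).2 ∈ G).card with hA
    have hk1' : volume.real I * s.toReal < (A : ℝ) / totientSum (k + 1) := by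
      have hne : (A : ℝ≥0∞) / (totientSum (k + 1) : ℝ≥0∞) ≠ ∞ :=
        ENNReal.div_ne_top (ENNReal.natCast_ne_top _)
          (by exact_mod_cast (totientSum_pos k.succ_pos).ne')
      have := (ENNReal.toReal_lt_toReal (ENNReal.mul_ne_top hfin hs_top) hne).2 hk1
      simpa [ENNReal.toReal_mul, ENNReal.toReal_div, measureReal_def] using this
    have hcard := card_filter_fareyPairs_le (Q := k + 1) hI G
    rw [← hA] at hcard
    rw [thirdMeasure_eq_meanDirac, meanDirac_apply _ _ hG.measurableSet, Finset.card_univ,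
      Fintype.card_fin] at hlt
    set B := ((Finset.univ : Finset (Fin (fareyCount (k + 1) I - h - 1))).filter
      fun j : Fin (fareyCount (k + 1) I - h - 1) =>
      (fun i : Fin h => fareyNormalized (k + 1) I ⟨(j : ℕ) + i + 2, by omega⟩ -
        fareyNormalized (k + 1) I ⟨(j : ℕ) + i, by omega⟩) ∈ G).card with hB
    have hB' : (B : ℝ) ≤ fareyCount (k + 1) I * r'.toReal := by
      rcases Nat.eq_zero_or_pos (fareyCount (k + 1) I - h - 1) with h0 | h0
      · have : B = 0 := by
          have h8 : B ≤ fareyCount (k + 1) I - h - 1 := by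
            rw [hB]
            exact (Finset.card_filter_le _ _).trans (by simp)
          omega
        rw [this, Nat.cast_zero]
        positivity
      · have h0' : (0 : ℝ) < (fareyCount (k + 1) I - h - 1 : ℕ) := by exact_mod_cast h0
        have h8 := (ENNReal.toReal_lt_toReal (ENNReal.div_ne_top (ENNReal.natCast_ne_top _)
          (by exact_mod_cast h0.ne')) hr'_top).2 hlt
        rw [ENNReal.toReal_div, ENNReal.toReal_natCast, ENNReal.toReal_natCast,
          div_lt_iff₀ h0'] at h8
        have h9 : ((fareyCount (k + 1) I - h - 1 : ℕ) : ℝ) ≤ fareyCount (k + 1) I := by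
          exact_mod_cast (by omega : fareyCount (k + 1) I - h - 1 ≤ fareyCount (k + 1) I)
        rw [mul_comm] at h8
        exact h8.le.trans (mul_le_mul_of_nonneg_right h9 ENNReal.toReal_nonneg)
    have hcard' : (A : ℝ) ≤ B + (h + 1 : ℕ) := by exact_mod_cast hcard
    have h10 : (A : ℝ) / totientSum (k + 1) ≤
        (fareyCount (k + 1) I : ℝ) / totientSum (k + 1) * r'.toReal +
          ((h + 1 : ℕ) : ℝ) / totientSum (k + 1) := by
      rw [div_mul_eq_mul_div, ← add_div]
      gcongr
      exact hcard'.trans (by linarith)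
    linarith
  exact hrr'.trans_le (le_liminf_of_le (by isBoundedDefault) h7)

theorem tendsto_fareyThirdMeasure (h : ℕ) {I : Set ℝ} (hI01 : I ⊆ Set.Icc 0 1)
    (hI : I.OrdConnected) (hn : I.Nontrivial) :
    Tendsto (fun Q : ℕ => fareyThirdMeasure h Q I) atTop
      (𝓝 (thirdLimitLaw h).toFiniteMeasure) := by
  classical
  have hfin : volume I ≠ ∞ := ne_top_of_le_ne_top (by simp) (measure_mono hI01)
  have hpos : 0 < volume.real I := ENNReal.toReal_pos (volume_pos_of_ordConnected hI hn).ne' hfin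
  -- The open-set criterion needs probability measures, so the possibly zero measures for small Q
  -- are replaced by the limit; this changes only finitely many terms.
  have hex : ∀ k : ℕ, ∃ ν : ProbabilityMeasure (Fin h → ℝ),
      IsProbabilityMeasure (thirdMeasure h (fareyNormalized (k + 1) I)) →
        (ν : Measure (Fin h → ℝ)) = thirdMeasure h (fareyNormalized (k + 1) I) := by
    intro k
    by_cases hp : IsProbabilityMeasure (thirdMeasure h (fareyNormalized (k + 1) I))
    · exact ⟨⟨_, hp⟩, fun _ => rfl⟩
    · exact ⟨thirdLimitLaw h, fun hp' => absurd hp' hp⟩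
  choose ν hν using hex
  have hlarge : ∀ᶠ k : ℕ in atTop, h + 1 < fareyCount (k + 1) I := by
    have h1 := (tendsto_fareyCount_div_totientSum hI01 hI).pos_mul_atTop hpos
      (tendsto_totientSum_atTop.comp (tendsto_add_atTop_nat 1))
    filter_upwards [h1.eventually_gt_atTop ((h + 1 : ℕ) : ℝ)] with k hk
    have h4 : (totientSum (k + 1) : ℝ) ≠ 0 := by exact_mod_cast (totientSum_pos k.succ_pos).ne'
    simp only [Function.comp] at hk
    rw [div_mul_cancel₀ _ h4] at hk
    exact_mod_cast hk
  have hνeq : ∀ᶠ k : ℕ in atTop, (ν k).toFiniteMeasure = fareyThirdMeasure h (k + 1) I := by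
    filter_upwards [hlarge] with k hk
    exact Subtype.ext (hν k (isProbabilityMeasure_thirdMeasure hk (fareyNormalized (k + 1) I)))
  have hlim : Tendsto ν atTop (𝓝 (thirdLimitLaw h)) := by
    refine tendsto_of_forall_isOpen_le_liminf' fun G hG => ?_
    refine (le_liminf_thirdMeasure hI01 hI hpos hG).trans (le_of_eq (liminf_congr ?_))
    filter_upwards [hνeq] with k hk
    have := congrArg (fun m : FiniteMeasure (Fin h → ℝ) => (m : Measure (Fin h → ℝ)) G) hk
    exact this.symm
  rw [← tendsto_add_atTop_iff_nat 1]
  exact ((ProbabilityMeasure.tendsto_nhds_iff_toFiniteMeasure_tendsto_nhds _).1 hlim).congr' hνeq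

end ThirdMeasure

theorem theorem1 (h : ℕ) (hh : 1 ≤ h) :
    ∃ μ : ProbabilityMeasure (Fin h → ℝ),
      (∀ I : Set ℝ, I ⊆ Set.Icc 0 1 → I.OrdConnected → I.Nontrivial →
        Tendsto (fun Q : ℕ => fareyThirdMeasure h Q I) atTop (𝓝 μ.toFiniteMeasure)) ∧
      (μ : Measure (Fin h → ℝ)).support = closure (fareyPhi h '' fareyTriangle) ∧
      (∀ α β : Fin h → ℝ, (∀ j, 0 ≤ α j) →
        (μ : Measure (Fin h → ℝ)) (Set.univ.pi fun j => Set.Ioo (α j) (β j)) =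
          2 * volume (fareyTriangle ∩ fareyPhi h ⁻¹' (Set.univ.pi fun j => Set.Ioo (α j) (β j)))) :=
  ⟨thirdLimitLaw h,
    fun _ hI01 hI hn => tendsto_fareyThirdMeasure h hI01 hI hn, support_thirdLimit h,
    fun _ _ _ => thirdLimit_apply h (MeasurableSet.univ_pi fun _ => measurableSet_Ioo)⟩
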